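/- Theorem (Mutual information collapse). Let $d\ge 0$ be an integer and $v>0$. Let $X_0$ be a random vector in $\mathbb{C}^d$ with an arbitrary law $\nu$ such that $\mathbb{E}\|X_0\|^2<\infty$. Let $Z_0,Z_1,\dots$ be i.i.d. centred complex Gaussian vectors in $\mathbb{C}^d$, independent of $X_0$, whose $2d$ real and imaginary parts are independent with variance $v$ (so $v=\tfrac12$ is the convention $Z_t\sim\mathcal{CN}(0,I_d)$, and $v=1$ is the convention of unit variance per real dimension). For $\alpha_t\in[0,1)$ put $$X_{t+1}=\alpha_t X_t+\sqrt{1-\alpha_t^2}\,Z_t,\qquad \bar\alpha_H=\prod_{t=0}^{H-1}\alpha_t,\qquad \gamma_H=\frac{\bar\alpha_H^2}{1-\bar\alpha_H^2}\qquad(H\ge 1).$$ Mutual information is measured in nats. Then there is a finite-valued function $J:[0,\infty)\to[0,\infty)$, depending only on $d$, $v$ and the law $\nu$ of $X_0$, such that: 1. For every number of steps $H\ge1$ and every schedule $\alpha_0,\dots,\alpha_{H-1}\in[0,1)$, $I(X_0;X_H)=J(\gamma_H)$. So the mutual information depends on the schedule only through the effective SNR $\gamma_H$, and not on how attenuation and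 noise are spread over the steps. 2. $J$ is continuous on $[0,\infty)$, and it is strictly increasing on $[0,\infty)$ if $X_0$ is non-degenerate (not almost surely constant). 3. As $\gamma\downarrow0$, $$J(\gamma)=\frac{\gamma}{2v}\,\mathbb{E}\|X_0-\mathbb{E}X_0\|^2+o(\gamma).$$ In particular, if $\mathbb{E}X_0=0$, then $J(\gamma)=\frac{\gamma}{2v}\,\mathbb{E}\|X_0\|^2+o(\gamma)$. That is, $I(X_0;X_H)=\frac{\gamma_H}{2}\mathbb{E}\|X_0\|^2+o(\gamma_H)$ for $v=1$, and $I(X_0;X_H)=\gamma_H\,\mathbb{E}\|X_0\|^2+o(\gamma_H)$ for $Z_t\sim\mathcal{CN}(0,I_d)$. -/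

import Mathlib

open MeasureTheory ProbabilityTheory Topology Asymptotics
open scoped NNReal ENNReal

/-- Mutual information `I(X; Y)` in nats: the Kullback-Leibler divergence of the joint law of
`(X, Y)` from the product of the marginal laws. -/
noncomputable def mutualInfo {Ω E F : Type*} [MeasurableSpace Ω] [MeasurableSpace E]
    [MeasurableSpace F] (P : Measure Ω) (X : Ω → E) (Y : Ω → F) : ℝ≥0∞ :=
  InformationTheory.klDiv (P.map (fun ω => (X ω, Y ω))) ((P.map X).prod (P.map Y))

/-- Law of a circularly symmetric centred complex Gaussian number whose real and imaginary parts
are independent real Gaussians of variance `v`; `v = 1/2` is the law `CN(0, 1)`. -/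
noncomputable def complexGaussian (v : ℝ≥0) : Measure ℂ :=
  ((gaussianReal 0 v).prod (gaussianReal 0 v)).map (fun p : ℝ × ℝ => (⟨p.1, p.2⟩ : ℂ))

/-- Law of a vector in `ℂ^d` with independent `complexGaussian v` coordinates: `v = 1/2` is
`CN(0, I_d)`, and `v = 1` is the standard Gaussian law on `ℂ^d = ℝ^(2d)`. -/
noncomputable def complexGaussianVec (d : ℕ) (v : ℝ≥0) : Measure (EuclideanSpace ℂ (Fin d)) :=
  (Measure.pi (fun _ : Fin d => complexGaussian v)).map (WithLp.toLp 2)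

/-- The recursion `X_{t+1} = α_t X_t + √(1 - α_t²) Z_t` started at `X_0`. -/
noncomputable def chain {Ω : Type*} {d : ℕ} (α : ℕ → ℝ) (X₀ : Ω → EuclideanSpace ℂ (Fin d))
    (Z : ℕ → Ω → EuclideanSpace ℂ (Fin d)) : ℕ → Ω → EuclideanSpace ℂ (Fin d)
  | 0 => X₀
  | t + 1 => fun ω => α t • chain α X₀ Z t ω + √(1 - α t ^ 2) • Z t ω

/-- Cumulative attenuation after `H` steps. -/
noncomputable def cumAttenuation (α : ℕ → ℝ) (H : ℕ) : ℝ := ∏ t ∈ Finset.range H, α t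

/-- Effective signal-to-noise ratio after `H` steps. -/
noncomputable def effectiveSNR (α : ℕ → ℝ) (H : ℕ) : ℝ :=
  cumAttenuation α H ^ 2 / (1 - cumAttenuation α H ^ 2)

/-!
Write `s = √γ` and let `p_s(x, z) = exp (⟪s x, z⟫ / v - ‖s x‖² / (2 v))` be the likelihood ratio of
`s x + Z` to `Z` (`gaussTilt`), with average `q_s(z) = E p_s(X, z)` (`mixTilt`) over the input law.

The noise collected along the chain is a Gaussian vector of variance `v (1 - ā²)` independent of the
input, whatever the schedule (`hasLaw_chainNoise`). After division by `√(1 - ā²)`, which preserves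
the information, the output is `s X + Z` with `s² = γ_H`, so the information is
`A(s) = ∫∫ q_s klFun (p_s / q_s)` (`gaussInfo`, `mutualInfo_chain`), and `J(γ) = A(√γ)`.

Everything else rests on the decomposition `A(s) + B(s) = s² E‖X‖² / (2 v)`
(`gaussInfo_add_outputDiv`), where `B(s) = ∫ klFun (q_s)` is the divergence of the law of `s X + Z`
from that of `Z` (`outputDiv`). Both `A` and `B` are integrals of nonnegative functions.

* Finiteness is immediate. Fatou's lemma makes `A` and `B` lower semicontinuous; as their sum is
  continuous, both are continuous (`continuous_gaussInfo`).
* The integrands of `A(s) / s²` and `B(s) / s²` converge pointwise to `⟪x - E X, z⟫² / (2 v²)` and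
  `⟪E X, z⟫² / (2 v²)`. By Fatou's lemma the lower limits are at least `E‖X - E X‖² / (2 v)` and
  `‖E X‖² / (2 v)`. These two bounds add up to the constant sum, so both are limits
  (`tendsto_gaussInfo_div_sq`). No moment beyond the second is needed.
* If `s² = r² + t²`, then an observation at amplitude `s` is equivalent to two independent ones at
  amplitudes `r` and `t`. The chain rule `outputDiv_eq_add` then shows that `A(s) - A(r)` is the
  average of the information at amplitude `t` for the posterior input law given the first
  observation. The posterior has the null sets of the input law, so for a non-degenerate input this
  average is positive (`gaussInfo_pos`, `gaussInfo_lt_gaussInfo`).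
-/

section IsoGaussian

open Filter InformationTheory
open scoped InnerProductSpace

variable {E : Type*} [NormedAddCommGroup E] [InnerProductSpace ℝ E]

/-! ### The Gaussian likelihood ratio -/

/-- The likelihood ratio at `z` of the Gaussian law shifted by `a` to the centred one. -/
noncomputable def gaussTilt (v : ℝ) (a z : E) : ℝ :=
  Real.exp (⟪a, z⟫_ℝ / v - ‖a‖ ^ 2 / (2 * v))

lemma gaussTilt_pos (v : ℝ) (a z : E) : 0 < gaussTilt v a z := Real.exp_pos _

@[simp] lemma gaussTilt_zero (v : ℝ) (z : E) : gaussTilt v 0 z = 1 := by simp [gaussTilt]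

lemma continuous_gaussTilt (v : ℝ) : Continuous fun p : E × E => gaussTilt v p.1 p.2 := by
  unfold gaussTilt
  fun_prop

@[fun_prop]
lemma Continuous.gaussTilt {α : Type*} [TopologicalSpace α] {f g : α → E} (v : ℝ)
    (hf : Continuous f) (hg : Continuous g) : Continuous fun x => gaussTilt v (f x) (g x) :=
  (continuous_gaussTilt v).comp (hf.prodMk hg)

lemma gaussTilt_eq {v : ℝ} (hv : 0 < v) (a z : E) :
    gaussTilt v a z = Real.exp (‖z‖ ^ 2 / (2 * v)) * Real.exp (-‖z - a‖ ^ 2 / (2 * v)) := by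
  rw [gaussTilt, ← Real.exp_add, norm_sub_sq_real, real_inner_comm]
  congr 1
  field_simp
  ring

/-- For a fixed observation the likelihood ratio is bounded in the shift. -/
lemma gaussTilt_le {v : ℝ} (hv : 0 < v) (a z : E) :
    gaussTilt v a z ≤ Real.exp (‖z‖ ^ 2 / (2 * v)) := by
  rw [gaussTilt_eq hv]
  refine mul_le_of_le_one_right (Real.exp_pos _).le (Real.exp_le_one_iff.2 ?_)
  rw [neg_div]
  exact neg_nonpos.2 (by positivity)

variable [FiniteDimensional ℝ E] [MeasurableSpace E] [BorelSpace E]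

@[fun_prop]
lemma Measurable.gaussTilt {α : Type*} [MeasurableSpace α] {f g : α → E} (v : ℝ)
    (hf : Measurable f) (hg : Measurable g) : Measurable fun x => gaussTilt v (f x) (g x) :=
  (continuous_gaussTilt v).measurable.comp (hf.prodMk hg)

/-! ### Isotropic Gaussian measures -/

/-- Lebesgue density of the centred Gaussian law with covariance `v • id`. The normalising constant
is written as the inverse of the total mass, which spares its explicit value. -/
noncomputable def isoGaussianPDF (E : Type*) [NormedAddCommGroup E] [InnerProductSpace ℝ E]
    [FiniteDimensional ℝ E] [MeasurableSpace E] [BorelSpace E] (v : ℝ) (z : E) : ℝ :=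
  (∫ y : E, Real.exp (-(2 * v)⁻¹ * ‖y‖ ^ 2))⁻¹ * Real.exp (-(2 * v)⁻¹ * ‖z‖ ^ 2)

/-- The centred Gaussian law with covariance `v • id` on a finite-dimensional inner product
space. -/
noncomputable def isoGaussian (E : Type*) [NormedAddCommGroup E] [InnerProductSpace ℝ E]
    [FiniteDimensional ℝ E] [MeasurableSpace E] [BorelSpace E] (v : ℝ) : Measure E :=
  volume.withDensity fun z => ENNReal.ofReal (isoGaussianPDF E v z)

lemma integral_exp_neg_mul_norm_sq_pos {v : ℝ} (hv : 0 < v) :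
    0 < ∫ y : E, Real.exp (-(2 * v)⁻¹ * ‖y‖ ^ 2) := by
  rw [GaussianFourier.integral_rexp_neg_mul_sq_norm (by positivity)]
  positivity

lemma isoGaussianPDF_pos {v : ℝ} (hv : 0 < v) (z : E) : 0 < isoGaussianPDF E v z :=
  mul_pos (inv_pos.2 (integral_exp_neg_mul_norm_sq_pos hv)) (Real.exp_pos _)

lemma continuous_isoGaussianPDF (v : ℝ) : Continuous (isoGaussianPDF E v) := by
  unfold isoGaussianPDF
  fun_prop

lemma integral_isoGaussianPDF {v : ℝ} (hv : 0 < v) : ∫ z, isoGaussianPDF E v z = 1 := by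
  unfold isoGaussianPDF
  rw [integral_const_mul]
  exact inv_mul_cancel₀ (integral_exp_neg_mul_norm_sq_pos hv).ne'

lemma isProbabilityMeasure_isoGaussian {v : ℝ} (hv : 0 < v) :
    IsProbabilityMeasure (isoGaussian E v) := by
  refine ⟨?_⟩
  have h := integral_isoGaussianPDF (E := E) hv
  have hint : Integrable (isoGaussianPDF E v) := by
    -- a non-integrable density would have integral `0` by convention
    by_contra hc
    rw [integral_undef hc] at h
    exact zero_ne_one h
  rw [isoGaussian, withDensity_apply _ MeasurableSet.univ, Measure.restrict_univ,
    ← ofReal_integral_eq_lintegral_ofReal hint (ae_of_all _ fun z => (isoGaussianPDF_pos hv z).le),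
    h, ENNReal.ofReal_one]

lemma charFun_isoGaussian {v : ℝ} (hv : 0 < v) (t : E) :
    charFun (isoGaussian E v) t = Complex.exp (-(v * ‖t‖ ^ 2 / 2 : ℝ)) := by
  have hb : 0 < (((2 * v)⁻¹ : ℝ) : ℂ).re := by
    rw [Complex.ofReal_re]; positivity
  have hZ := integral_exp_neg_mul_norm_sq_pos (E := E) hv
  have h1 := GaussianFourier.integral_cexp_neg_mul_sq_norm_add hb Complex.I t
  have h2 : (((∫ y : E, Real.exp (-(2 * v)⁻¹ * ‖y‖ ^ 2) : ℝ)) : ℂ) =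
      (Real.pi / ((2 * v)⁻¹ : ℝ)) ^ (Module.finrank ℝ E / 2 : ℂ) := by
    rw [← GaussianFourier.integral_cexp_neg_mul_sq_norm hb, ← integral_complex_ofReal]
    congr 1; ext y; push_cast; rfl
  rw [charFun_apply, isoGaussian, integral_withDensity_eq_integral_toReal_smul
    ((continuous_isoGaussianPDF v).measurable.ennreal_ofReal) (by simp)]
  have h3 : ∀ x : E, (ENNReal.ofReal (isoGaussianPDF E v x)).toReal •
      Complex.exp (⟪x, t⟫_ℝ * Complex.I) =
      ((∫ y : E, Real.exp (-(2 * v)⁻¹ * ‖y‖ ^ 2) : ℝ) : ℂ)⁻¹ *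
      Complex.exp (-((2 * v)⁻¹ : ℝ) * ‖x‖ ^ 2 + Complex.I * ⟪t, x⟫_ℝ) := by
    intro x
    rw [ENNReal.toReal_ofReal (isoGaussianPDF_pos hv x).le, isoGaussianPDF, Complex.real_smul,
      Complex.exp_add, real_inner_comm, mul_comm Complex.I]
    push_cast
    ring
  simp_rw [h3]
  rw [integral_const_mul, h1, h2, ← mul_assoc, inv_mul_cancel₀, one_mul]
  · congr 1
    have hv' : (v : ℂ) ≠ 0 := by exact_mod_cast hv.ne'
    rw [Complex.I_sq]
    push_cast
    field_simp
    norm_num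
  · rw [← h2]
    exact_mod_cast hZ.ne'

/-- Independent isotropic Gaussian vectors add up: variances are additive. -/
lemma map_linearComb_isoGaussian {v : ℝ} (hv : 0 < v) {a b : ℝ} (hab : a ^ 2 + b ^ 2 = 1) :
    ((isoGaussian E v).prod (isoGaussian E v)).map (fun p => a • p.1 + b • p.2) =
      isoGaussian E v := by
  have := isProbabilityMeasure_isoGaussian (E := E) hv
  have hmap : ((isoGaussian E v).prod (isoGaussian E v)).map (fun p => a • p.1 + b • p.2) =
      (((isoGaussian E v).map (a • ·)).prod ((isoGaussian E v).map (b • ·))).map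
        (fun p => p.1 + p.2) := by
    rw [Measure.map_prod_map _ _ (by fun_prop) (by fun_prop),
      Measure.map_map (by fun_prop) (by fun_prop)]
    rfl
  have : IsProbabilityMeasure ((isoGaussian E v).map (a • ·)) :=
    Measure.isProbabilityMeasure_map (by fun_prop)
  have : IsProbabilityMeasure ((isoGaussian E v).map (b • ·)) :=
    Measure.isProbabilityMeasure_map (by fun_prop)
  rw [hmap]
  refine Measure.ext_of_charFun ?_
  rw [charFun_map_add_prod_eq_mul]
  ext t
  rw [Pi.mul_apply, charFun_map_smul, charFun_map_smul, charFun_isoGaussian hv,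
    charFun_isoGaussian hv, charFun_isoGaussian hv, ← Complex.exp_add, norm_smul, norm_smul,
    mul_pow, mul_pow, Real.norm_eq_abs, Real.norm_eq_abs, sq_abs, sq_abs]
  congr 1
  have : v * ‖t‖ ^ 2 / 2 = v * (a ^ 2 * ‖t‖ ^ 2) / 2 + v * (b ^ 2 * ‖t‖ ^ 2) / 2 := by
    linear_combination -(v * ‖t‖ ^ 2 / 2) * hab
  rw [this]
  push_cast
  ring

lemma map_inner_isoGaussian {v : ℝ≥0} (hv : 0 < v) (a : E) :
    (isoGaussian E v).map (fun z => ⟪a, z⟫_ℝ) = gaussianReal 0 (v * ‖a‖₊ ^ 2) := by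
  have := isProbabilityMeasure_isoGaussian (E := E) (v := v) (by exact_mod_cast hv)
  refine Measure.ext_of_charFun ?_
  ext u
  have h : charFun ((isoGaussian E v).map (fun z => ⟪a, z⟫_ℝ)) u
      = charFun (isoGaussian E v) (u • a) := by
    rw [charFun_apply_real, integral_map (by fun_prop)
      (Continuous.aestronglyMeasurable (by fun_prop)), charFun_apply]
    congr 1; ext z
    rw [real_inner_smul_right, real_inner_comm]
    push_cast; rfl
  rw [h, charFun_isoGaussian (by exact_mod_cast hv), charFun_gaussianReal, norm_smul, mul_pow,
    Real.norm_eq_abs, sq_abs]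
  congr 1
  push_cast
  ring

lemma integrable_inner_isoGaussian {v : ℝ≥0} (hv : 0 < v) (a : E) :
    Integrable (fun z => ⟪a, z⟫_ℝ) (isoGaussian E v) := by
  have h : Integrable id ((isoGaussian E v).map (fun z => ⟪a, z⟫_ℝ)) := by
    rw [map_inner_isoGaussian hv]
    exact (memLp_id_gaussianReal' 1 (by simp)).integrable le_rfl
  exact (integrable_map_measure (f := fun z => ⟪a, z⟫_ℝ) (g := id) (by fun_prop)
    (by fun_prop)).1 h

lemma integral_inner_isoGaussian {v : ℝ≥0} (hv : 0 < v) (a : E) :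
    ∫ z, ⟪a, z⟫_ℝ ∂(isoGaussian E v) = 0 := by
  have h : ∫ x, x ∂((isoGaussian E v).map (fun z => ⟪a, z⟫_ℝ)) = 0 := by
    rw [map_inner_isoGaussian hv, integral_id_gaussianReal]
  rwa [integral_map (by fun_prop) (by fun_prop)] at h

lemma lintegral_inner_sq_isoGaussian {v : ℝ≥0} (hv : 0 < v) (a : E) :
    ∫⁻ z, ENNReal.ofReal (⟪a, z⟫_ℝ ^ 2) ∂(isoGaussian E v) = ENNReal.ofReal (v * ‖a‖ ^ 2) := by
  have h : ∫⁻ x, ENNReal.ofReal (x ^ 2) ∂((isoGaussian E v).map (fun z => ⟪a, z⟫_ℝ)) =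
      ENNReal.ofReal (v * ‖a‖ ^ 2) := by
    rw [map_inner_isoGaussian hv, ← ofReal_integral_eq_lintegral_ofReal
      (f := fun x : ℝ => x ^ 2) (memLp_id_gaussianReal' 2 (by simp)).integrable_sq
      (ae_of_all _ fun x => sq_nonneg x)]
    congr 1
    have := variance_of_integral_eq_zero (X := fun x : ℝ => x)
      (μ := gaussianReal 0 (v * ‖a‖₊ ^ 2)) (by fun_prop) (by simp)
    rw [variance_fun_id_gaussianReal] at this
    simpa using this.symm
  rwa [lintegral_map (by fun_prop) (by fun_prop)] at h

lemma isOpenPosMeasure_isoGaussian {v : ℝ} (hv : 0 < v) :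
    (isoGaussian E v).IsOpenPosMeasure := by
  refine (withDensity_absolutelyContinuous' (μ := (volume : Measure E)) ?_ ?_).isOpenPosMeasure
  · exact (continuous_isoGaussianPDF v).measurable.ennreal_ofReal.aemeasurable
  · exact ae_of_all _ fun z => by
      simpa using isoGaussianPDF_pos hv z

lemma lintegral_add_isoGaussian {v : ℝ} (hv : 0 < v) (a : E) {g : E → ℝ≥0∞} (hg : Measurable g) :
    ∫⁻ z, g (a + z) ∂(isoGaussian E v) =
      ∫⁻ z, ENNReal.ofReal (gaussTilt v a z) * g z ∂(isoGaussian E v) := by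
  have hm := (continuous_isoGaussianPDF (E := E) v).measurable.ennreal_ofReal
  rw [isoGaussian, lintegral_withDensity_eq_lintegral_mul _ hm (by fun_prop),
    lintegral_withDensity_eq_lintegral_mul _ hm (by fun_prop),
    ← lintegral_add_left_eq_self _ (-a)]
  refine lintegral_congr fun z => ?_
  simp only [Pi.mul_apply]
  rw [add_neg_cancel_left, ← mul_assoc, ← ENNReal.ofReal_mul (isoGaussianPDF_pos hv z).le]
  congr 2
  rw [isoGaussianPDF, isoGaussianPDF, gaussTilt_eq hv, mul_assoc]
  congr 1
  rw [← Real.exp_add, ← Real.exp_add, neg_add_eq_sub]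
  congr 1
  field_simp
  ring

/-- Cameron–Martin formula for isotropic Gaussian laws. -/
lemma map_add_isoGaussian {v : ℝ} (hv : 0 < v) (a : E) :
    (isoGaussian E v).map (fun z => a + z) =
      (isoGaussian E v).withDensity fun z => ENNReal.ofReal (gaussTilt v a z) := by
  refine Measure.ext_of_lintegral _ fun g hg => ?_
  rw [lintegral_map hg (by fun_prop), lintegral_add_isoGaussian hv a hg,
    lintegral_withDensity_eq_lintegral_mul _ (by fun_prop) hg]
  rfl

lemma lintegral_gaussTilt {v : ℝ} (hv : 0 < v) (a : E) :
    ∫⁻ z, ENNReal.ofReal (gaussTilt v a z) ∂(isoGaussian E v) = 1 := by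
  have := isProbabilityMeasure_isoGaussian (E := E) hv
  have h := lintegral_add_isoGaussian hv a (g := fun _ => 1) measurable_const
  simpa using h.symm

/-- The Kullback–Leibler divergence between Gaussian laws shifted by `a` and by `0`. -/
lemma lintegral_klFun_gaussTilt {v : ℝ≥0} (hv : 0 < v) (a : E) :
    ∫⁻ z, ENNReal.ofReal (klFun (gaussTilt v a z)) ∂(isoGaussian E v) =
      ENNReal.ofReal (‖a‖ ^ 2 / (2 * v)) := by
  have hv' : (0 : ℝ) < v := by exact_mod_cast hv
  have := isProbabilityMeasure_isoGaussian (E := E) hv'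
  set G := isoGaussian E v
  have h1 : Integrable (fun z => gaussTilt v a z) G :=
    (lintegral_ofReal_ne_top_iff_integrable (Measurable.aestronglyMeasurable (by fun_prop))
      (ae_of_all _ fun z => (gaussTilt_pos _ _ _).le)).1 (by rw [lintegral_gaussTilt hv']; simp)
  have h1' : ∫ z, gaussTilt v a z ∂G = 1 := by
    rw [integral_eq_lintegral_of_nonneg_ae (ae_of_all _ fun z => (gaussTilt_pos _ _ _).le)
      (Measurable.aestronglyMeasurable (by fun_prop)), lintegral_gaussTilt hv']
    simp
  have hl : Integrable (fun z => ⟪a, z⟫_ℝ / v - ‖a‖ ^ 2 / (2 * v))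
      (G.map (fun z => a + z)) := by
    rw [integrable_map_measure (Continuous.aestronglyMeasurable (by fun_prop)) (by fun_prop)]
    simp only [Function.comp_def, inner_add_right]
    have := integrable_inner_isoGaussian (E := E) hv a
    exact (((integrable_const _).add this).div_const _).sub (integrable_const _)
  have hlv : ∫ z, (⟪a, z⟫_ℝ / v - ‖a‖ ^ 2 / (2 * v)) ∂(G.map (fun z => a + z)) =
      ‖a‖ ^ 2 / (2 * v) := by
    rw [integral_map (by fun_prop) (Continuous.aestronglyMeasurable (by fun_prop))]
    simp only [inner_add_right]
    have := integrable_inner_isoGaussian (E := E) hv a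
    have h2 : Integrable (fun x => (⟪a, a⟫_ℝ + ⟪a, x⟫_ℝ) / (v : ℝ)) G :=
      ((integrable_const _).add this).div_const _
    rw [integral_sub h2 (integrable_const _),
      integral_div, integral_add (integrable_const _) this, integral_inner_isoGaussian hv]
    simp only [integral_const, probReal_univ, smul_eq_mul, one_mul, add_zero,
      real_inner_self_eq_norm_sq]
    field_simp
    ring
  rw [map_add_isoGaussian hv'] at hl hlv
  rw [integrable_withDensity_iff_integrable_smul' (by fun_prop) (by simp)] at hl
  rw [integral_withDensity_eq_integral_toReal_smul (by fun_prop) (by simp)] at hlv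
  have he : ∀ z, (ENNReal.ofReal (gaussTilt v a z)).toReal •
      (⟪a, z⟫_ℝ / v - ‖a‖ ^ 2 / (2 * v)) = gaussTilt v a z * Real.log (gaussTilt v a z) := by
    intro z
    rw [ENNReal.toReal_ofReal (gaussTilt_pos _ _ _).le, smul_eq_mul]
    conv_rhs => rw [gaussTilt, Real.log_exp]
    rfl
  simp_rw [he] at hl hlv
  have hint : Integrable (fun z => klFun (gaussTilt v a z)) G := by
    simp only [klFun_apply]
    exact (hl.add (integrable_const _)).sub h1
  rw [← ofReal_integral_eq_lintegral_ofReal hint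
    (ae_of_all _ fun z => klFun_nonneg (gaussTilt_pos _ _ _).le)]
  congr 1
  simp only [klFun_apply]
  have h2 : Integrable (fun z => gaussTilt v a z * Real.log (gaussTilt v a z) + 1) G :=
    hl.add (integrable_const _)
  rw [integral_sub h2 h1, integral_add hl (integrable_const _), hlv, h1']
  simp

end IsoGaussian

section Mixture

open Filter InformationTheory
open scoped InnerProductSpace

/-! ### Splitting the divergence of a mixture -/

lemma klFun_le_sq_add_one {x : ℝ} (hx : 0 ≤ x) : klFun x ≤ x ^ 2 + 1 := by
  have := mul_le_mul_of_nonneg_left (Real.log_le_self hx) hx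
  rw [klFun_apply]
  nlinarith

lemma klFun_mul {a b : ℝ} (ha : 0 < a) (hb : 0 < b) :
    klFun (a * b) = b * klFun a + a * klFun b + (1 - a) * (1 - b) := by
  rw [klFun_apply, klFun_apply, klFun_apply, Real.log_mul ha.ne' hb.ne']
  ring

/-- Compensation identity: the average of `klFun ∘ f` is its value at the average `q` of `f` plus
the average Bregman gap `q * klFun (f / q)`. -/
lemma lintegral_klFun_eq_add {α : Type*} [MeasurableSpace α] {μ : Measure α}
    [IsProbabilityMeasure μ] {f : α → ℝ} (hf : Measurable f) (hpos : ∀ x, 0 < f x) {C : ℝ}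
    (hC : ∀ x, f x ≤ C) :
    ∫⁻ x, ENNReal.ofReal (klFun (f x)) ∂μ =
      ∫⁻ x, ENNReal.ofReal ((∫ y, f y ∂μ) * klFun (f x / ∫ y, f y ∂μ)) ∂μ +
        ENNReal.ofReal (klFun (∫ y, f y ∂μ)) := by
  have hfi : Integrable f μ := .of_bound hf.aestronglyMeasurable C <| ae_of_all _ fun x => by
    rw [Real.norm_eq_abs, abs_of_pos (hpos x)]; exact hC x
  have hq : 0 < ∫ y, f y ∂μ := by
    rw [integral_pos_iff_support_of_nonneg (fun x => (hpos x).le) hfi]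
    have : Function.support f = Set.univ := Set.eq_univ_of_forall fun x => (hpos x).ne'
    simp [this]
  set q := ∫ y, f y ∂μ with hqdef
  have hdiv : ∀ x, 0 < f x / q := fun x => div_pos (hpos x) hq
  have hgi : Integrable (fun x => q * klFun (f x / q)) μ := by
    refine Integrable.const_mul (.of_bound (C := (C / q) ^ 2 + 1)
      (measurable_klFun.comp (hf.div_const q)).aestronglyMeasurable <| ae_of_all _ fun x => ?_) q
    rw [Function.comp_apply, Real.norm_eq_abs, abs_of_nonneg (klFun_nonneg (hdiv x).le)]
    refine (klFun_le_sq_add_one (hdiv x).le).trans ?_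
    have : f x / q ≤ C / q := by have := hC x; gcongr
    have := (hdiv x).le
    gcongr
  -- the correction term is linear in `f` and has mean zero
  have hkey : ∀ x, klFun (f x) = q * klFun (f x / q) + klFun q + (f x - q) * Real.log q := by
    intro x
    rw [klFun_apply, klFun_apply, klFun_apply, Real.log_div (hpos x).ne' hq.ne']
    field_simp
    ring
  have h1 : Integrable (fun x => q * klFun (f x / q) + klFun q) μ := hgi.add (integrable_const _)
  have h2 : Integrable (fun x => (f x - q) * Real.log q) μ :=
    (hfi.sub (integrable_const _)).mul_const _
  have hki : Integrable (fun x => klFun (f x)) μ := by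
    simp_rw [hkey]
    exact h1.add h2
  rw [← ofReal_integral_eq_lintegral_ofReal hki (ae_of_all _ fun x => klFun_nonneg (hpos x).le),
    ← ofReal_integral_eq_lintegral_ofReal hgi
      (ae_of_all _ fun x => mul_nonneg hq.le (klFun_nonneg (hdiv x).le)),
    ← ENNReal.ofReal_add
      (integral_nonneg fun x => mul_nonneg hq.le (klFun_nonneg (hdiv x).le)) (klFun_nonneg hq.le)]
  congr 1
  simp_rw [hkey]
  rw [integral_add h1 h2, integral_add hgi (integrable_const _), integral_mul_const,
    integral_sub hfi (integrable_const _)]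
  simp [hqdef]

/-! ### Information through the Gaussian channel -/

variable {E : Type*} [NormedAddCommGroup E] [MeasurableSpace E]

/-- The average over the input of the divergence of the law of `s • x + Z` from the law of `Z`. -/
noncomputable def shiftDiv (v : ℝ) (ν : Measure E) (s : ℝ) : ℝ≥0∞ :=
  ∫⁻ x, ENNReal.ofReal (s ^ 2 * ‖x‖ ^ 2 / (2 * v)) ∂ν

lemma shiftDiv_eq_ofReal (v : ℝ≥0) {ν : Measure E} (hν : MemLp id 2 ν) (s : ℝ) :
    shiftDiv v ν s = ENNReal.ofReal (s ^ 2 / (2 * v) * ∫ x, ‖x‖ ^ 2 ∂ν) := by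
  have hi : Integrable (fun x : E => ‖x‖ ^ 2) ν := by simpa using hν.integrable_norm_pow two_ne_zero
  rw [← integral_const_mul, ofReal_integral_eq_lintegral_ofReal (hi.const_mul _)
    (ae_of_all _ fun x => by positivity), shiftDiv]
  exact lintegral_congr fun x => by congr 1; ring

lemma shiftDiv_ne_top (v : ℝ≥0) {ν : Measure E} (hν : MemLp id 2 ν) (s : ℝ) :
    shiftDiv v ν s ≠ ∞ := by
  rw [shiftDiv_eq_ofReal v hν]
  exact ENNReal.ofReal_ne_top

lemma shiftDiv_add (v : ℝ≥0) {ν : Measure E} (hν : MemLp id 2 ν) {r t s : ℝ}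
    (h : r ^ 2 + t ^ 2 = s ^ 2) : shiftDiv v ν s = shiftDiv v ν r + shiftDiv v ν t := by
  have hM : 0 ≤ ∫ x, ‖x‖ ^ 2 ∂ν := integral_nonneg fun x => sq_nonneg _
  rw [shiftDiv_eq_ofReal v hν, shiftDiv_eq_ofReal v hν, shiftDiv_eq_ofReal v hν,
    ← ENNReal.ofReal_add (by positivity) (by positivity), ← h]
  congr 1
  ring

variable [InnerProductSpace ℝ E]

/-- Density of the output `s • X + Z` of the Gaussian channel with input law `ν`, relative to the
law of the noise `Z`. -/
noncomputable def mixTilt (v : ℝ) (ν : Measure E) (s : ℝ) (z : E) : ℝ :=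
  ∫ x, gaussTilt v (s • x) z ∂ν

@[simp] lemma mixTilt_zero (v : ℝ) (ν : Measure E) [IsProbabilityMeasure ν] (z : E) :
    mixTilt v ν 0 z = 1 := by
  simp [mixTilt]

variable [FiniteDimensional ℝ E] [BorelSpace E]

/-- The mutual information between `X` and `s • X + Z`, written as a Bregman divergence relative to
the product of the input law and the noise law. -/
noncomputable def gaussInfo (v : ℝ) (ν : Measure E) (s : ℝ) : ℝ≥0∞ :=
  ∫⁻ p, ENNReal.ofReal (mixTilt v ν s p.2 * klFun (gaussTilt v (s • p.1) p.2 / mixTilt v ν s p.2))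
    ∂(ν.prod (isoGaussian E v))

/-- The divergence of the law of `s • X + Z` from the law of `Z`. -/
noncomputable def outputDiv (v : ℝ) (ν : Measure E) (s : ℝ) : ℝ≥0∞ :=
  ∫⁻ z, ENNReal.ofReal (klFun (mixTilt v ν s z)) ∂(isoGaussian E v)

lemma integrable_gaussTilt {v : ℝ} (hv : 0 < v) (ν : Measure E) [IsFiniteMeasure ν] (s : ℝ) (z : E) :
    Integrable (fun x => gaussTilt v (s • x) z) ν :=
  .of_bound (Measurable.aestronglyMeasurable (by fun_prop)) (Real.exp (‖z‖ ^ 2 / (2 * v))) <|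
    ae_of_all _ fun x => by
      rw [Real.norm_eq_abs, abs_of_pos (gaussTilt_pos _ _ _)]
      exact gaussTilt_le hv _ _

lemma mixTilt_pos {v : ℝ} (hv : 0 < v) (ν : Measure E) [IsProbabilityMeasure ν] (s : ℝ) (z : E) :
    0 < mixTilt v ν s z := by
  rw [mixTilt, integral_pos_iff_support_of_nonneg (fun x => (gaussTilt_pos _ _ _).le)
    (integrable_gaussTilt hv ν s z)]
  have : Function.support (fun x => gaussTilt v (s • x) z) = Set.univ :=
    Set.eq_univ_of_forall fun x => (gaussTilt_pos _ _ _).ne'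
  simp [this]

@[fun_prop]
lemma measurable_mixTilt (v : ℝ) (ν : Measure E) [SFinite ν] (s : ℝ) :
    Measurable (mixTilt v ν s) := by
  unfold mixTilt
  exact (StronglyMeasurable.integral_prod_right' (f := fun p : E × E => gaussTilt v (s • p.2) p.1)
    (Measurable.stronglyMeasurable (by fun_prop))).measurable

@[fun_prop]
lemma measurable_gaussInfo_integrand (v : ℝ) (ν : Measure E) [SFinite ν] (s : ℝ) :
    Measurable fun p : E × E =>
      mixTilt v ν s p.2 * klFun (gaussTilt v (s • p.1) p.2 / mixTilt v ν s p.2) := by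
  have := measurable_mixTilt v ν s
  fun_prop

lemma ofReal_mixTilt {v : ℝ} (hv : 0 < v) (ν : Measure E) [IsFiniteMeasure ν] (s : ℝ) (z : E) :
    ENNReal.ofReal (mixTilt v ν s z) = ∫⁻ x, ENNReal.ofReal (gaussTilt v (s • x) z) ∂ν :=
  ofReal_integral_eq_lintegral_ofReal (integrable_gaussTilt hv ν s z)
    (ae_of_all _ fun _ => (gaussTilt_pos _ _ _).le)

lemma lintegral_mixTilt {v : ℝ} (hv : 0 < v) (ν : Measure E) [IsProbabilityMeasure ν] (s : ℝ) :
    ∫⁻ z, ENNReal.ofReal (mixTilt v ν s z) ∂(isoGaussian E v) = 1 := by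
  have := isProbabilityMeasure_isoGaussian (E := E) hv
  simp_rw [ofReal_mixTilt hv]
  rw [lintegral_lintegral_swap (Measurable.aemeasurable (by fun_prop))]
  simp [lintegral_gaussTilt hv]

/-- The average divergence of the shifted noise splits into the information and the divergence of
the output. -/
lemma gaussInfo_add_outputDiv {v : ℝ≥0} (hv : 0 < v) (ν : Measure E) [IsProbabilityMeasure ν]
    (s : ℝ) : gaussInfo v ν s + outputDiv v ν s = shiftDiv v ν s := by
  have hv' : (0 : ℝ) < v := by exact_mod_cast hv
  have := isProbabilityMeasure_isoGaussian (E := E) hv'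
  have hA : gaussInfo v ν s = ∫⁻ z, ∫⁻ x, ENNReal.ofReal
      (mixTilt v ν s z * klFun (gaussTilt v (s • x) z / mixTilt v ν s z)) ∂ν ∂isoGaussian E v := by
    rw [gaussInfo, lintegral_prod_symm _ (Measurable.aemeasurable (by fun_prop))]
  have hB : ∀ z : E, ∫⁻ x, ENNReal.ofReal
      (mixTilt v ν s z * klFun (gaussTilt v (s • x) z / mixTilt v ν s z)) ∂ν +
      ENNReal.ofReal (klFun (mixTilt v ν s z)) =
      ∫⁻ x, ENNReal.ofReal (klFun (gaussTilt v (s • x) z)) ∂ν := fun z =>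
    (lintegral_klFun_eq_add (by fun_prop) (fun x => gaussTilt_pos _ _ _)
      (fun x => gaussTilt_le hv' _ _)).symm
  have hm : Measurable fun z => ENNReal.ofReal (klFun (mixTilt v ν s z)) :=
    (measurable_klFun.comp (measurable_mixTilt _ ν s)).ennreal_ofReal
  rw [hA, outputDiv, ← lintegral_add_right _ hm]
  simp_rw [hB]
  rw [lintegral_lintegral_swap (Measurable.aemeasurable (by fun_prop)), shiftDiv]
  simp_rw [lintegral_klFun_gaussTilt hv, norm_smul, mul_pow, Real.norm_eq_abs, sq_abs]

lemma gaussInfo_ne_top {v : ℝ≥0} (hv : 0 < v) {ν : Measure E} [IsProbabilityMeasure ν]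
    (hν : MemLp id 2 ν) (s : ℝ) : gaussInfo v ν s ≠ ∞ :=
  ne_top_of_le_ne_top (shiftDiv_ne_top v hν s) (gaussInfo_add_outputDiv hv ν s ▸ le_self_add)

lemma outputDiv_ne_top {v : ℝ≥0} (hv : 0 < v) {ν : Measure E} [IsProbabilityMeasure ν]
    (hν : MemLp id 2 ν) (s : ℝ) : outputDiv v ν s ≠ ∞ :=
  ne_top_of_le_ne_top (shiftDiv_ne_top v hν s) (gaussInfo_add_outputDiv hv ν s ▸ le_add_self)

end Mixture

section Asymptotics

open Filter InformationTheory
open scoped InnerProductSpace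

/-! ### Limits of the information -/

/-- If `a + b` converges to `A + B` while neither summand loses mass in the limit, then `a`
converges to `A`. -/
lemma ENNReal.tendsto_of_add_of_le_liminf {ι : Type*} {l : Filter ι} [l.NeBot] {a b : ι → ℝ≥0∞}
    {A B : ℝ≥0∞} (hc : Tendsto (fun i => a i + b i) l (𝓝 (A + B))) (hAB : A + B ≠ ∞)
    (ha : A ≤ liminf a l) (hb : B ≤ liminf b l) : Tendsto a l (𝓝 A) := by
  refine tendsto_of_le_liminf_of_limsup_le ha ?_
  have hle : limsup a l ≤ A + B := by
    rw [← hc.limsup_eq]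
    exact limsup_le_limsup (Eventually.of_forall fun i => le_self_add)
  have hB : B ≤ A + B - limsup a l := by
    refine le_of_forall_lt fun B' hB' => ?_
    obtain ⟨B'', h1, h2⟩ := exists_between hB'
    refine h1.trans_le (ENNReal.le_sub_of_add_le_left (ne_top_of_le_ne_top hAB hle) ?_)
    have hev : ∀ᶠ i in l, a i ≤ a i + b i - B'' := by
      filter_upwards [eventually_lt_of_lt_liminf (h2.trans_le hb)] with i hi
      refine ENNReal.le_sub_of_add_le_right h2.ne_top ?_
      gcongr
    have hlim : Tendsto (fun i => a i + b i - B'') l (𝓝 (A + B - B'')) :=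
      ENNReal.Tendsto.sub hc tendsto_const_nhds (Or.inl hAB)
    have := limsup_le_limsup hev
    rw [hlim.limsup_eq] at this
    calc limsup a l + B'' ≤ A + B - B'' + B'' := by gcongr
      _ = A + B := tsub_add_cancel_of_le (h2.le.trans le_add_self)
  have h3 : limsup a l + B ≤ A + B := by
    calc limsup a l + B ≤ limsup a l + (A + B - limsup a l) := by gcongr
      _ = A + B := add_tsub_cancel_of_le hle
  exact (ENNReal.add_le_add_iff_right (ne_top_of_le_ne_top hAB le_add_self)).1 h3

/-- Fatou's lemma for a pointwise convergent family. -/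
lemma lintegral_le_liminf_of_tendsto {α ι : Type*} [MeasurableSpace α] {μ : Measure α}
    {l : Filter ι} [l.NeBot] [l.IsCountablyGenerated] {f : ι → α → ℝ} {g : α → ℝ}
    (hf : ∀ i, Measurable (f i)) (h : ∀ x, Tendsto (fun i => f i x) l (𝓝 (g x))) :
    ∫⁻ x, ENNReal.ofReal (g x) ∂μ ≤ liminf (fun i => ∫⁻ x, ENNReal.ofReal (f i x) ∂μ) l := by
  refine le_trans (le_of_eq (lintegral_congr fun x => ?_))
    (lintegral_liminf_le fun i => (hf i).ennreal_ofReal)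
  exact ((ENNReal.tendsto_ofReal (h x)).liminf_eq).symm

lemma tendsto_klFun_div_sq : Tendsto (fun x => klFun x / (x - 1) ^ 2) (𝓝[≠] 1) (𝓝 (1 / 2)) := by
  have hne : ∀ᶠ x : ℝ in 𝓝[≠] 1, x ≠ 0 :=
    eventually_nhdsWithin_of_eventually_nhds (eventually_ne_nhds one_ne_zero)
  refine HasDerivAt.lhopital_zero_nhdsNE (f' := Real.log) (g' := fun x => 2 * (x - 1)) ?_ ?_ ?_ ?_
    ?_ ?_
  · filter_upwards [hne] with x hx using hasDerivAt_klFun hx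
  · refine Eventually.of_forall fun x => ?_
    simpa using ((hasDerivAt_id' x).sub_const 1).fun_pow 2
  · filter_upwards [self_mem_nhdsWithin] with x hx
    exact mul_ne_zero two_ne_zero (sub_ne_zero.2 hx)
  · have := continuous_klFun.tendsto 1
    rw [klFun_one] at this
    exact this.mono_left nhdsWithin_le_nhds
  · have : Continuous fun x : ℝ => (x - 1) ^ 2 := by fun_prop
    have := this.tendsto 1
    simp only [sub_self, ne_eq, OfNat.ofNat_ne_zero, not_false_eq_true, zero_pow] at this
    exact this.mono_left nhdsWithin_le_nhds
  · have := (hasDerivAt_iff_tendsto_slope.1 (Real.hasDerivAt_log one_ne_zero)).const_mul (1 / 2)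
    simp only [inv_one, mul_one] at this
    refine this.congr fun x => ?_
    rw [slope_def_field, Real.log_one, sub_zero, mul_comm 2, div_mul_eq_div_div]
    ring

/-- Second-order expansion of `klFun` along a curve through its minimiser. -/
lemma tendsto_klFun_comp_div_sq {r : ℝ → ℝ} {c : ℝ} (hr : HasDerivAt r c 0) (h0 : r 0 = 1) :
    Tendsto (fun s => klFun (r s) / s ^ 2) (𝓝[>] 0) (𝓝 (c ^ 2 / 2)) := by
  -- the quotient is filled in at `1`, since the curve may return to `1` near `0`
  set κ : ℝ → ℝ := Function.update (fun x => klFun x / (x - 1) ^ 2) 1 (1 / 2) with hκ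
  have hκc : ContinuousAt κ 1 := continuousAt_update_same.2 tendsto_klFun_div_sq
  have hκm : ∀ x, klFun x = κ x * (x - 1) ^ 2 := by
    intro x
    rcases eq_or_ne x 1 with rfl | hx
    · simp [klFun_one]
    · rw [hκ, Function.update_of_ne hx, div_mul_cancel₀]
      exact pow_ne_zero 2 (sub_ne_zero.2 hx)
  have h1 : Tendsto (fun s => κ (r s)) (𝓝[>] 0) (𝓝 (1 / 2)) := by
    have hr0 : Tendsto r (𝓝[>] 0) (𝓝 1) := h0 ▸ hr.continuousAt.tendsto.mono_left nhdsWithin_le_nhds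
    have h2 : Tendsto κ (𝓝 1) (𝓝 (1 / 2)) := by
      have := hκc.tendsto
      rwa [hκ, Function.update_self] at this
    exact h2.comp hr0
  have h2 : Tendsto (fun s => (r s - 1) / s) (𝓝[>] 0) (𝓝 c) := by
    have := (hasDerivAt_iff_tendsto_slope.1 hr).mono_left
      (nhdsWithin_mono 0 fun s (hs : 0 < s) => hs.ne')
    refine this.congr fun s => ?_
    rw [slope_def_field, h0, sub_zero]
  have := h1.mul (h2.pow 2)
  rw [show c ^ 2 / 2 = 1 / 2 * c ^ 2 by ring]
  refine this.congr fun s => ?_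
  rw [hκm (r s), div_pow]
  ring

variable {E : Type*} [NormedAddCommGroup E] [InnerProductSpace ℝ E]

lemma hasDerivAt_gaussTilt_smul {v : ℝ} (x z : E) (s : ℝ) :
    HasDerivAt (fun s : ℝ => gaussTilt v (s • x) z)
      (gaussTilt v (s • x) z * (⟪x, z⟫_ℝ / v - s * ‖x‖ ^ 2 / v)) s := by
  have h1 : ∀ s : ℝ, gaussTilt v (s • x) z =
      Real.exp (s * (⟪x, z⟫_ℝ / v) - s ^ 2 * (‖x‖ ^ 2 / (2 * v))) := by
    intro s
    rw [gaussTilt, real_inner_smul_left, norm_smul, mul_pow, Real.norm_eq_abs, sq_abs]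
    congr 1
    ring
  simp_rw [h1]
  have h2 : HasDerivAt (fun s : ℝ => s * (⟪x, z⟫_ℝ / v) - s ^ 2 * (‖x‖ ^ 2 / (2 * v)))
      (⟪x, z⟫_ℝ / v - s * ‖x‖ ^ 2 / v) s := by
    have := ((hasDerivAt_id s).mul_const (⟪x, z⟫_ℝ / v)).sub
      (((hasDerivAt_id s).pow 2).mul_const (‖x‖ ^ 2 / (2 * v)))
    refine this.congr_deriv ?_
    simp only [id_eq]
    field_simp
    ring
  exact h2.exp

variable [FiniteDimensional ℝ E] [MeasurableSpace E]

lemma integral_norm_sub_mean_sq {ν : Measure E} [IsProbabilityMeasure ν] (hν : MemLp id 2 ν) :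
    ∫ x, ‖x - ∫ y, y ∂ν‖ ^ 2 ∂ν = ∫ x, ‖x‖ ^ 2 ∂ν - ‖∫ x, x ∂ν‖ ^ 2 := by
  have hi1 : Integrable (fun x : E => x) ν := hν.integrable one_le_two
  have hi2 : Integrable (fun x : E => ‖x‖ ^ 2) ν := by simpa using hν.integrable_norm_pow two_ne_zero
  set m := ∫ x, x ∂ν with hm
  have hi3 : Integrable (fun x : E => 2 * ⟪m, x⟫_ℝ) ν := (hi1.const_inner m).const_mul 2
  have hi4 : Integrable (fun x : E => ‖x‖ ^ 2 - 2 * ⟪m, x⟫_ℝ) ν := hi2.sub hi3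
  simp_rw [norm_sub_sq_real, real_inner_comm m]
  rw [integral_add hi4 (integrable_const _), integral_sub hi2 hi3, integral_const_mul,
    integral_inner hi1, ← hm, real_inner_self_eq_norm_sq]
  simp only [integral_const, probReal_univ, smul_eq_mul, one_mul]
  ring

variable [BorelSpace E]

lemma continuous_mixTilt_left {v : ℝ} (hv : 0 < v) (ν : Measure E) [IsFiniteMeasure ν] (z : E) :
    Continuous fun s => mixTilt v ν s z := by
  unfold mixTilt
  refine continuous_of_dominated (bound := fun _ => Real.exp (‖z‖ ^ 2 / (2 * v)))
    (fun s => Measurable.aestronglyMeasurable (by fun_prop))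
    (fun s => ae_of_all _ fun x => ?_) (integrable_const _) (ae_of_all _ fun x => by fun_prop)
  rw [Real.norm_eq_abs, abs_of_pos (gaussTilt_pos _ _ _)]
  exact gaussTilt_le hv _ _

/-- The information is continuous in the amplitude: by Fatou's lemma both it and the output
divergence are lower semicontinuous, and their sum is continuous. -/
lemma continuous_gaussInfo {v : ℝ≥0} (hv : 0 < v) {ν : Measure E} [IsProbabilityMeasure ν]
    (hν : MemLp id 2 ν) : Continuous (gaussInfo v ν) := by
  have hv' : (0 : ℝ) < v := by exact_mod_cast hv
  refine continuous_iff_continuousAt.2 fun s₀ => ?_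
  refine ENNReal.tendsto_of_add_of_le_liminf (b := outputDiv v ν) (B := outputDiv v ν s₀)
    ?_ ?_ ?_ ?_
  · simp_rw [gaussInfo_add_outputDiv hv, shiftDiv_eq_ofReal v hν]
    exact (ENNReal.continuous_ofReal.comp (by fun_prop)).tendsto s₀
  · rw [gaussInfo_add_outputDiv hv]
    exact shiftDiv_ne_top v hν s₀
  · refine lintegral_le_liminf_of_tendsto (fun s => by fun_prop) fun p => ?_
    have h1 := continuous_mixTilt_left hv' ν p.2
    have h2 : Continuous fun s : ℝ => gaussTilt v (s • p.1) p.2 := by fun_prop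
    exact (h1.mul (continuous_klFun.comp
      (h2.div h1 fun s => (mixTilt_pos hv' ν s p.2).ne'))).tendsto s₀
  · refine lintegral_le_liminf_of_tendsto
      (fun s => measurable_klFun.comp (measurable_mixTilt _ ν s)) fun z => ?_
    exact (continuous_klFun.comp (continuous_mixTilt_left hv' ν z)).tendsto s₀

lemma hasDerivAt_mixTilt {v : ℝ} (hv : 0 < v) {ν : Measure E} [IsProbabilityMeasure ν]
    (hν : MemLp id 2 ν) (z : E) :
    HasDerivAt (fun s => mixTilt v ν s z) (⟪∫ x, x ∂ν, z⟫_ℝ / v) 0 := by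
  have hi1 : Integrable (fun x : E => x) ν := hν.integrable one_le_two
  have hi2 : Integrable (fun x : E => ‖x‖ ^ 2) ν := by simpa using hν.integrable_norm_pow two_ne_zero
  have h := (hasDerivAt_integral_of_dominated_loc_of_deriv_le (μ := ν) (x₀ := (0 : ℝ))
    (F := fun s x => gaussTilt v (s • x) z) (s := Metric.ball 0 1)
    (F' := fun s x => gaussTilt v (s • x) z * (⟪x, z⟫_ℝ / v - s * ‖x‖ ^ 2 / v))
    (bound := fun x => Real.exp (‖z‖ ^ 2 / (2 * v)) * (‖x‖ * ‖z‖ / v + ‖x‖ ^ 2 / v))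
    (Metric.ball_mem_nhds _ one_pos)
    (Eventually.of_forall fun s => Measurable.aestronglyMeasurable (by fun_prop))
    (integrable_gaussTilt hv ν 0 z) (Measurable.aestronglyMeasurable (by fun_prop))
    (ae_of_all _ fun x s hs => ?_)
    ((((hi1.norm.mul_const _).div_const _).add (hi2.div_const _)).const_mul _)
    (ae_of_all _ fun x s _ => hasDerivAt_gaussTilt_smul x z s)).2
  · refine h.congr_deriv ?_
    simp only [zero_smul, gaussTilt_zero, one_mul, zero_mul, zero_div, sub_zero]
    rw [integral_div]
    simp_rw [real_inner_comm z]
    rw [integral_inner hi1]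
  · have hs' : |s| ≤ 1 := by simpa using (mem_ball_zero_iff.1 hs).le
    rw [norm_mul, Real.norm_eq_abs, abs_of_pos (gaussTilt_pos _ _ _)]
    refine mul_le_mul (gaussTilt_le hv _ _) ?_ (norm_nonneg _) (Real.exp_pos _).le
    refine (norm_sub_le _ _).trans (add_le_add ?_ ?_)
    · rw [norm_div, Real.norm_of_nonneg hv.le]
      have := abs_real_inner_le_norm x z
      rw [← Real.norm_eq_abs] at this
      gcongr
    · rw [norm_div, norm_mul, Real.norm_of_nonneg hv.le, Real.norm_of_nonneg (sq_nonneg ‖x‖),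
        Real.norm_eq_abs]
      have := mul_le_of_le_one_left (sq_nonneg ‖x‖) hs'
      gcongr

/-- Small-amplitude limit of the information. Fatou's lemma bounds the lower limits of the rescaled
information and of the rescaled output divergence, and the two bounds add up to the rescaled sum. -/
lemma tendsto_gaussInfo_div_sq {v : ℝ≥0} (hv : 0 < v) {ν : Measure E} [IsProbabilityMeasure ν]
    (hν : MemLp id 2 ν) :
    Tendsto (fun s : ℝ => gaussInfo v ν s * ENNReal.ofReal (s ^ 2)⁻¹) (𝓝[>] 0)
      (𝓝 (ENNReal.ofReal ((∫ x, ‖x - ∫ y, y ∂ν‖ ^ 2 ∂ν) / (2 * v)))) := by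
  have hv' : (0 : ℝ) < v := by exact_mod_cast hv
  have := isProbabilityMeasure_isoGaussian (E := E) hv'
  set m := ∫ y, y ∂ν with hm
  have hadd : ENNReal.ofReal ((∫ x, ‖x - m‖ ^ 2 ∂ν) / (2 * v)) + ENNReal.ofReal (‖m‖ ^ 2 / (2 * v))
      = ENNReal.ofReal ((∫ x, ‖x‖ ^ 2 ∂ν) / (2 * v)) := by
    rw [← ENNReal.ofReal_add (div_nonneg (integral_nonneg fun x => sq_nonneg _) (by positivity))
      (by positivity), integral_norm_sub_mean_sq hν, ← hm]
    congr 1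
    ring
  -- Gaussian average of the squared linear functional that the second-order term produces
  have hsq : ∀ a : E, ∫⁻ z, ENNReal.ofReal ((⟪a, z⟫_ℝ / v) ^ 2 / 2) ∂(isoGaussian E v) =
      ENNReal.ofReal (‖a‖ ^ 2 / (2 * v)) := by
    intro a
    have h1 : ∀ z : E, ENNReal.ofReal ((⟪a, z⟫_ℝ / v) ^ 2 / 2) =
        ENNReal.ofReal (1 / (2 * v ^ 2)) * ENNReal.ofReal (⟪a, z⟫_ℝ ^ 2) := by
      intro z
      rw [← ENNReal.ofReal_mul (by positivity)]
      congr 1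
      field_simp
    simp_rw [h1]
    rw [lintegral_const_mul _ (by fun_prop), lintegral_inner_sq_isoGaussian hv,
      ← ENNReal.ofReal_mul (by positivity)]
    congr 1
    field_simp
  refine ENNReal.tendsto_of_add_of_le_liminf
    (b := fun s : ℝ => outputDiv v ν s * ENNReal.ofReal (s ^ 2)⁻¹)
    (B := ENNReal.ofReal (‖m‖ ^ 2 / (2 * v))) ?_ ?_ ?_ ?_
  · simp_rw [← add_mul, gaussInfo_add_outputDiv hv, shiftDiv_eq_ofReal v hν]
    rw [hadd]
    refine tendsto_const_nhds.congr' ?_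
    filter_upwards [self_mem_nhdsWithin] with s (hs : 0 < s)
    rw [← ENNReal.ofReal_mul (mul_nonneg (by positivity) (integral_nonneg fun x => sq_nonneg _))]
    congr 1
    field_simp
  · rw [hadd]
    exact ENNReal.ofReal_ne_top
  · have hL : ENNReal.ofReal ((∫ x, ‖x - m‖ ^ 2 ∂ν) / (2 * v)) =
        ∫⁻ p, ENNReal.ofReal ((⟪p.1 - m, p.2⟫_ℝ / v) ^ 2 / 2) ∂(ν.prod (isoGaussian E v)) := by
      rw [lintegral_prod _ (Measurable.aemeasurable (by fun_prop))]
      simp_rw [hsq]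
      have hi : Integrable (fun x : E => ‖x - m‖ ^ 2) ν := by
        simpa using (hν.sub (memLp_const m)).integrable_norm_pow two_ne_zero
      rw [← integral_div, ofReal_integral_eq_lintegral_ofReal (hi.div_const _)
        (ae_of_all _ fun x => by positivity)]
    have hR : ∀ s : ℝ, gaussInfo v ν s * ENNReal.ofReal (s ^ 2)⁻¹ =
        ∫⁻ p, ENNReal.ofReal (mixTilt v ν s p.2 *
          klFun (gaussTilt v (s • p.1) p.2 / mixTilt v ν s p.2) / s ^ 2)
          ∂(ν.prod (isoGaussian E v)) := by
      intro s
      rw [gaussInfo, ← lintegral_mul_const _ (by fun_prop)]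
      refine lintegral_congr fun p => ?_
      rw [div_eq_mul_inv _ (s ^ 2), ENNReal.ofReal_mul' (q := (s ^ 2)⁻¹) (by positivity)]
    rw [hL]
    simp_rw [hR]
    refine lintegral_le_liminf_of_tendsto
      (fun s => (measurable_gaussInfo_integrand _ ν s).div_const _) fun p => ?_
    have hq := hasDerivAt_mixTilt hv' hν p.2
    have hp := hasDerivAt_gaussTilt_smul (v := v) p.1 p.2 0
    have hd := hp.div hq (mixTilt_pos hv' ν 0 p.2).ne'
    have h1 := tendsto_klFun_comp_div_sq hd (by simp)
    have h2 : Tendsto (fun s => mixTilt v ν s p.2) (𝓝[>] 0) (𝓝 1) := by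
      have := hq.continuousAt.tendsto.mono_left (nhdsWithin_le_nhds (s := Set.Ioi 0))
      simpa using this
    have h3 := h2.mul h1
    simp only [zero_smul, gaussTilt_zero, mixTilt_zero] at h3
    convert h3 using 2
    · simp only [Pi.div_apply]
      ring
    · rw [inner_sub_left, ← hm]
      ring
  · rw [← hsq m]
    have hR : ∀ s : ℝ, outputDiv v ν s * ENNReal.ofReal (s ^ 2)⁻¹ =
        ∫⁻ z, ENNReal.ofReal (klFun (mixTilt v ν s z) / s ^ 2) ∂(isoGaussian E v) := by
      intro s
      have hm : Measurable fun z => ENNReal.ofReal (klFun (mixTilt v ν s z)) :=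
        (measurable_klFun.comp (measurable_mixTilt _ ν s)).ennreal_ofReal
      rw [outputDiv, ← lintegral_mul_const _ hm]
      refine lintegral_congr fun z => ?_
      rw [div_eq_mul_inv, ENNReal.ofReal_mul' (by positivity)]
    simp_rw [hR]
    exact lintegral_le_liminf_of_tendsto
      (fun s => (measurable_klFun.comp (measurable_mixTilt _ ν s)).div_const _) fun z =>
        tendsto_klFun_comp_div_sq (hasDerivAt_mixTilt hv' hν z) (by simp)

end Asymptotics

section StrictMonotone

open Filter InformationTheory
open scoped InnerProductSpace

/-! ### Strict monotonicity of the information -/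

/-- Chain rule for the divergence when a probability density `b` is scaled by a constant. -/
lemma lintegral_klFun_const_mul {α : Type*} [MeasurableSpace α] {μ : Measure α}
    [IsProbabilityMeasure μ] {b : α → ℝ} (hb : Measurable b) (hpos : ∀ x, 0 < b x)
    (h1 : ∫⁻ x, ENNReal.ofReal (b x) ∂μ = 1)
    (hfin : ∫⁻ x, ENNReal.ofReal (klFun (b x)) ∂μ ≠ ∞) {a : ℝ} (ha : 0 < a) :
    ∫⁻ x, ENNReal.ofReal (klFun (a * b x)) ∂μ =
      ENNReal.ofReal (klFun a) + ENNReal.ofReal a * ∫⁻ x, ENNReal.ofReal (klFun (b x)) ∂μ := by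
  have hbi : Integrable b μ :=
    (lintegral_ofReal_ne_top_iff_integrable hb.aestronglyMeasurable
      (ae_of_all _ fun x => (hpos x).le)).1 (by rw [h1]; simp)
  have hb1 : ∫ x, b x ∂μ = 1 := by
    rw [integral_eq_lintegral_of_nonneg_ae (ae_of_all _ fun x => (hpos x).le)
      hb.aestronglyMeasurable, h1, ENNReal.toReal_one]
  have hki : Integrable (fun x => klFun (b x)) μ :=
    (lintegral_ofReal_ne_top_iff_integrable (measurable_klFun.comp hb).aestronglyMeasurable
      (ae_of_all _ fun x => klFun_nonneg (hpos x).le)).1 hfin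
  have h2 : Integrable (fun x => b x * klFun a + a * klFun (b x)) μ :=
    (hbi.mul_const _).add (hki.const_mul _)
  have h3 : Integrable (fun x => (1 - a) * (1 - b x)) μ :=
    ((integrable_const _).sub hbi).const_mul _
  have h4 : Integrable (fun x => klFun (a * b x)) μ := by
    simp_rw [fun x => klFun_mul ha (hpos x)]
    exact h2.add h3
  rw [← ofReal_integral_eq_lintegral_ofReal h4
      (ae_of_all _ fun x => klFun_nonneg (mul_pos ha (hpos x)).le),
    ← ofReal_integral_eq_lintegral_ofReal hki (ae_of_all _ fun x => klFun_nonneg (hpos x).le),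
    ← ENNReal.ofReal_mul ha.le, ← ENNReal.ofReal_add (klFun_nonneg ha.le)
      (mul_nonneg ha.le (integral_nonneg fun x => klFun_nonneg (hpos x).le))]
  congr 1
  simp_rw [fun x => klFun_mul ha (hpos x)]
  rw [integral_add h2 h3, integral_add (hbi.mul_const _) (hki.const_mul _), integral_mul_const,
    integral_const_mul, integral_const_mul, integral_sub (integrable_const _) hbi, hb1]
  simp

variable {E : Type*} [NormedAddCommGroup E] [InnerProductSpace ℝ E]

/-- Two observations with independent noises carry the same likelihood as the single observation of
their optimal combination. -/
lemma gaussTilt_mul_gaussTilt (v : ℝ) {r t s : ℝ} (hs : s ≠ 0) (h : r ^ 2 + t ^ 2 = s ^ 2)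
    (x z w : E) :
    gaussTilt v (r • x) z * gaussTilt v (t • x) w =
      gaussTilt v (s • x) ((r / s) • z + (t / s) • w) := by
  simp only [gaussTilt, ← Real.exp_add, norm_smul, mul_pow, Real.norm_eq_abs, sq_abs, ← h,
    inner_add_right, real_inner_smul_left, real_inner_smul_right]
  congr 1
  field_simp
  ring

lemma eq_of_forall_gaussTilt_eq {v : ℝ} (hv : 0 < v) {a b : E}
    (h : ∀ z, gaussTilt v a z = gaussTilt v b z) : a = b := by
  have h1 : ∀ z, ⟪a, z⟫_ℝ / v - ‖a‖ ^ 2 / (2 * v) = ⟪b, z⟫_ℝ / v - ‖b‖ ^ 2 / (2 * v) :=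
    fun z => Real.exp_injective (h z)
  have h0 := h1 0
  have h2 := h1 (a - b)
  simp only [inner_zero_right, zero_div, zero_sub, neg_inj] at h0
  rw [h0, sub_left_inj, div_left_inj' hv.ne', ← sub_eq_zero, ← inner_sub_left] at h2
  exact sub_eq_zero.1 (inner_self_eq_zero.1 h2)

variable [MeasurableSpace E]

/-- The conditional law of the input given the output `z` of the Gaussian channel. -/
noncomputable def gaussPosterior (v : ℝ) (ν : Measure E) (s : ℝ) (z : E) : Measure E :=
  ν.withDensity fun x => ENNReal.ofReal (gaussTilt v (s • x) z / mixTilt v ν s z)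

variable [FiniteDimensional ℝ E] [BorelSpace E]

lemma isProbabilityMeasure_gaussPosterior {v : ℝ} (hv : 0 < v) (ν : Measure E)
    [IsProbabilityMeasure ν] (s : ℝ) (z : E) : IsProbabilityMeasure (gaussPosterior v ν s z) := by
  have hq := mixTilt_pos hv ν s z
  refine ⟨?_⟩
  rw [gaussPosterior, withDensity_apply _ MeasurableSet.univ, Measure.restrict_univ,
    ← ofReal_integral_eq_lintegral_ofReal ((integrable_gaussTilt hv ν s z).div_const _)
      (ae_of_all _ fun x => div_nonneg (gaussTilt_pos _ _ _).le hq.le), integral_div]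
  change ENNReal.ofReal (mixTilt v ν s z / mixTilt v ν s z) = 1
  rw [div_self hq.ne', ENNReal.ofReal_one]

lemma memLp_gaussPosterior {v : ℝ} (hv : 0 < v) {ν : Measure E} [IsProbabilityMeasure ν]
    (hν : MemLp id 2 ν) (s : ℝ) (z : E) : MemLp id 2 (gaussPosterior v ν s z) := by
  refine hν.of_measure_le_smul (c := ENNReal.ofReal
    (Real.exp (‖z‖ ^ 2 / (2 * v)) / mixTilt v ν s z)) ENNReal.ofReal_ne_top ?_
  rw [← withDensity_const]
  refine withDensity_mono (ae_of_all _ fun x => ENNReal.ofReal_le_ofReal ?_)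
  have := mixTilt_pos hv ν s z
  have := gaussTilt_le hv (s • x) z
  gcongr

lemma absolutelyContinuous_gaussPosterior {v : ℝ} (hv : 0 < v) (ν : Measure E)
    [IsProbabilityMeasure ν] (s : ℝ) (z : E) : ν ≪ gaussPosterior v ν s z :=
  withDensity_absolutelyContinuous' (Measurable.aemeasurable (by fun_prop)) <|
    ae_of_all _ fun x => by
      simpa using div_pos (gaussTilt_pos v (s • x) z) (mixTilt_pos hv ν s z)

/-- Bayes' formula. -/
lemma ofReal_mixTilt_mul_lintegral_gaussPosterior {v : ℝ} (hv : 0 < v) (ν : Measure E)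
    [IsProbabilityMeasure ν] (s : ℝ) (z : E) {g : E → ℝ≥0∞} (hg : Measurable g) :
    ENNReal.ofReal (mixTilt v ν s z) * ∫⁻ x, g x ∂(gaussPosterior v ν s z) =
      ∫⁻ x, ENNReal.ofReal (gaussTilt v (s • x) z) * g x ∂ν := by
  have hq := mixTilt_pos hv ν s z
  rw [gaussPosterior, lintegral_withDensity_eq_lintegral_mul _ (by fun_prop) hg,
    ← lintegral_const_mul _ (by fun_prop)]
  refine lintegral_congr fun x => ?_
  rw [Pi.mul_apply, ← mul_assoc, ← ENNReal.ofReal_mul hq.le, mul_div_cancel₀ _ hq.ne']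

/-- The density of a pair of observations factors through the first one. -/
lemma mixTilt_linearComb {v : ℝ} (hv : 0 < v) (ν : Measure E) [IsProbabilityMeasure ν] {r t s : ℝ}
    (hs : s ≠ 0) (h : r ^ 2 + t ^ 2 = s ^ 2) (z w : E) :
    mixTilt v ν s ((r / s) • z + (t / s) • w) =
      mixTilt v ν r z * mixTilt v (gaussPosterior v ν r z) t w := by
  have hq := mixTilt_pos hv ν r z
  rw [mixTilt.eq_1 v (gaussPosterior v ν r z), gaussPosterior,
    integral_withDensity_eq_integral_toReal_smul (by fun_prop) (by simp), ← integral_const_mul,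
    mixTilt.eq_1 v ν s]
  refine integral_congr_ae (ae_of_all _ fun x => ?_)
  dsimp only
  rw [← gaussTilt_mul_gaussTilt v hs h, smul_eq_mul,
    ENNReal.toReal_ofReal (div_nonneg (gaussTilt_pos _ _ _).le hq.le)]
  field_simp

/-- Chain rule for the output divergence: the output at amplitude `s` is replaced by a pair of
independent observations at amplitudes `r` and `t`. -/
lemma outputDiv_eq_add {v : ℝ≥0} (hv : 0 < v) {ν : Measure E} [IsProbabilityMeasure ν]
    (hν : MemLp id 2 ν) {r t s : ℝ} (hs : s ≠ 0) (h : r ^ 2 + t ^ 2 = s ^ 2) :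
    outputDiv v ν s = outputDiv v ν r + ∫⁻ z, ENNReal.ofReal (mixTilt v ν r z) *
      outputDiv v (gaussPosterior v ν r z) t ∂(isoGaussian E v) := by
  have hv' : (0 : ℝ) < v := by exact_mod_cast hv
  have := isProbabilityMeasure_isoGaussian (E := E) hv'
  have hrot : (r / s) ^ 2 + (t / s) ^ 2 = 1 := by
    rw [div_pow, div_pow, ← add_div, h, div_self (pow_ne_zero 2 hs)]
  have hm : ∀ u, Measurable fun z => ENNReal.ofReal (klFun (mixTilt v ν u z)) := fun u =>
    (measurable_klFun.comp (measurable_mixTilt _ ν u)).ennreal_ofReal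
  have hpair : outputDiv v ν s = ∫⁻ z, ∫⁻ w, ENNReal.ofReal
      (klFun (mixTilt v ν s ((r / s) • z + (t / s) • w))) ∂isoGaussian E v ∂isoGaussian E v := by
    have hc : Measurable fun p : E × E => (r / s) • p.1 + (t / s) • p.2 := by fun_prop
    rw [outputDiv]
    conv_lhs => rw [← map_linearComb_isoGaussian hv' hrot]
    rw [lintegral_map (hm s) hc]
    exact lintegral_prod _ ((hm s).comp hc).aemeasurable
  rw [hpair, outputDiv, ← lintegral_add_left (hm r)]
  refine lintegral_congr fun z => ?_
  have := isProbabilityMeasure_gaussPosterior hv' ν r z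
  simp_rw [mixTilt_linearComb hv' ν hs h]
  exact lintegral_klFun_const_mul (measurable_mixTilt _ _ t) (mixTilt_pos hv' _ t)
    (lintegral_mixTilt hv' _ t) (outputDiv_ne_top hv (memLp_gaussPosterior hv' hν r z) t)
    (mixTilt_pos hv' ν r z)

/-- The information vanishes only if the likelihood does not depend on the input, that is for a
deterministic input. -/
lemma gaussInfo_pos {v : ℝ} (hv : 0 < v) {ν : Measure E} [IsProbabilityMeasure ν]
    (hne : ¬ ∃ c, ∀ᵐ x ∂ν, x = c) {t : ℝ} (ht : t ≠ 0) : 0 < gaussInfo v ν t := by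
  have := isProbabilityMeasure_isoGaussian (E := E) hv
  have := isOpenPosMeasure_isoGaussian (E := E) hv
  refine pos_iff_ne_zero.2 fun h0 => hne ?_
  rw [gaussInfo, lintegral_eq_zero_iff (by fun_prop)] at h0
  have h1 : ∀ᵐ x ∂ν, ∀ᵐ z ∂(isoGaussian E v), gaussTilt v (t • x) z = mixTilt v ν t z := by
    filter_upwards [Measure.ae_ae_of_ae_prod h0] with x hx
    filter_upwards [hx] with z hz
    have hq := mixTilt_pos hv ν t z
    have hd := div_pos (gaussTilt_pos v (t • x) z) hq
    have h2 : mixTilt v ν t z * klFun (gaussTilt v (t • x) z / mixTilt v ν t z) ≤ 0 :=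
      ENNReal.ofReal_eq_zero.1 hz
    have h3 := klFun_nonneg hd.le
    have h4 : klFun (gaussTilt v (t • x) z / mixTilt v ν t z) = 0 :=
      le_antisymm (nonpos_of_mul_nonpos_right h2 hq) h3
    exact (div_eq_one_iff_eq hq.ne').1 ((klFun_eq_zero_iff hd.le).1 h4)
  -- any input that realises the average likelihood serves as the constant
  obtain ⟨c, hc⟩ := h1.exists
  refine ⟨c, ?_⟩
  filter_upwards [h1] with x hx
  have hae : (fun z => gaussTilt v (t • x) z) =ᵐ[isoGaussian E v] fun z => gaussTilt v (t • c) z := by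
    filter_upwards [hx, hc] with z h2 h3
    rw [h2, h3]
  have heq := (Continuous.ae_eq_iff_eq (isoGaussian E v) (by fun_prop) (by fun_prop)).1 hae
  exact smul_right_injective E ht (eq_of_forall_gaussTilt_eq hv fun z => congr_fun heq z)

/-- Averaging the second moment of the posterior over the output returns that of the input. -/
lemma lintegral_mixTilt_mul_shiftDiv {v : ℝ} (hv : 0 < v) (ν : Measure E) [IsProbabilityMeasure ν]
    (r t : ℝ) :
    ∫⁻ z, ENNReal.ofReal (mixTilt v ν r z) * shiftDiv v (gaussPosterior v ν r z) t
      ∂(isoGaussian E v) = shiftDiv v ν t := by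
  have := isProbabilityMeasure_isoGaussian (E := E) hv
  simp_rw [shiftDiv, fun z => ofReal_mixTilt_mul_lintegral_gaussPosterior hv ν r z
    (g := fun x => ENNReal.ofReal (t ^ 2 * ‖x‖ ^ 2 / (2 * v))) (by fun_prop)]
  rw [lintegral_lintegral_swap (Measurable.aemeasurable (by fun_prop))]
  refine lintegral_congr fun x => ?_
  rw [lintegral_mul_const _ (by fun_prop), lintegral_gaussTilt hv, one_mul]

/-- An additional independent observation of a random input strictly increases the information: the
gain is the average information of that observation under the posterior law. -/
lemma gaussInfo_lt_gaussInfo {v : ℝ≥0} (hv : 0 < v) {ν : Measure E} [IsProbabilityMeasure ν]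
    (hν : MemLp id 2 ν) (hne : ¬ ∃ c, ∀ᵐ x ∂ν, x = c) {r s : ℝ} (hr : 0 ≤ r) (hrs : r < s) :
    gaussInfo v ν r < gaussInfo v ν s := by
  have hv' : (0 : ℝ) < v := by exact_mod_cast hv
  have := isProbabilityMeasure_isoGaussian (E := E) hv'
  obtain ⟨t, ht, h⟩ : ∃ t : ℝ, t ≠ 0 ∧ r ^ 2 + t ^ 2 = s ^ 2 := by
    have hlt : 0 < s ^ 2 - r ^ 2 := sub_pos.2 (by gcongr)
    exact ⟨√(s ^ 2 - r ^ 2), (Real.sqrt_pos.2 hlt).ne', by rw [Real.sq_sqrt hlt.le]; ring⟩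
  have hs : s ≠ 0 := (hr.trans_lt hrs).ne'
  have hchain := outputDiv_eq_add hv hν hs h
  have hB : outputDiv v ν s < outputDiv v ν r + shiftDiv v ν t := by
    rw [hchain, ← lintegral_mixTilt_mul_shiftDiv hv' ν r t]
    refine ENNReal.add_lt_add_left (outputDiv_ne_top hv hν r) ?_
    refine lintegral_strict_mono (IsProbabilityMeasure.ne_zero _) ?_ ?_
      (ae_of_all _ fun z => ?_)
    · simp_rw [shiftDiv, fun z => ofReal_mixTilt_mul_lintegral_gaussPosterior hv' ν r z
        (g := fun x => ENNReal.ofReal (t ^ 2 * ‖x‖ ^ 2 / (2 * v))) (by fun_prop)]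
      exact (Measurable.lintegral_prod_right' (f := fun p : E × E =>
        ENNReal.ofReal (gaussTilt v (r • p.2) p.1) * ENNReal.ofReal (t ^ 2 * ‖p.2‖ ^ 2 / (2 * v)))
        (by fun_prop)).aemeasurable
    · exact ne_top_of_le_ne_top (outputDiv_ne_top hv hν s) (hchain ▸ le_add_self)
    · have := isProbabilityMeasure_gaussPosterior hv' ν r z
      have hpost := memLp_gaussPosterior hv' hν r z
      have hpos := gaussInfo_pos hv' (ν := gaussPosterior v ν r z) (fun ⟨c, hc⟩ =>
        hne ⟨c, (absolutelyContinuous_gaussPosterior hv' ν r z).ae_le hc⟩) ht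
      refine (ENNReal.mul_lt_mul_iff_right
        (ENNReal.ofReal_pos.2 (mixTilt_pos hv' ν r z)).ne' ENNReal.ofReal_ne_top).2 ?_
      rw [← gaussInfo_add_outputDiv hv, add_comm]
      exact ENNReal.lt_add_right (outputDiv_ne_top hv hpost t) hpos.ne'
  have hsum : gaussInfo v ν s + outputDiv v ν s =
      gaussInfo v ν r + (outputDiv v ν r + shiftDiv v ν t) := by
    rw [gaussInfo_add_outputDiv hv, ← add_assoc, gaussInfo_add_outputDiv hv, shiftDiv_add v hν h]
  by_contra! hle
  have hlt := ENNReal.add_lt_add_of_le_of_lt (gaussInfo_ne_top hv hν s) hle hB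
  exact hlt.ne hsum

end StrictMonotone

section Channel

open Filter InformationTheory
open scoped InnerProductSpace

/-! ### Mutual information of the Gaussian channel -/

lemma klDiv_map_measurableEquiv {α β : Type*} [MeasurableSpace α] [MeasurableSpace β]
    (μ ν : Measure α) [IsFiniteMeasure μ] [IsFiniteMeasure ν] (e : α ≃ᵐ β) :
    klDiv (μ.map e) (ν.map e) = klDiv μ ν := by
  refine le_antisymm (klDiv_map_le μ ν e.measurable) ?_
  have h := klDiv_map_le (μ.map e) (ν.map e) e.symm.measurable
  rwa [e.map_symm_map, e.map_symm_map] at h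

lemma klDiv_withDensity_withDensity {α : Type*} [MeasurableSpace α] {μ : Measure α} [SigmaFinite μ]
    {p q : α → ℝ} (hp : Measurable p) (hq : Measurable q) (hp0 : ∀ x, 0 < p x)
    (hq0 : ∀ x, 0 < q x) [IsFiniteMeasure (μ.withDensity fun x => ENNReal.ofReal (p x))]
    [IsFiniteMeasure (μ.withDensity fun x => ENNReal.ofReal (q x))] :
    klDiv (μ.withDensity fun x => ENNReal.ofReal (p x))
      (μ.withDensity fun x => ENNReal.ofReal (q x)) =
      ∫⁻ x, ENNReal.ofReal (q x * klFun (p x / q x)) ∂μ := by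
  set μq := μ.withDensity fun x => ENNReal.ofReal (q x) with hμq
  have hpq : μ.withDensity (fun x => ENNReal.ofReal (p x)) =
      μq.withDensity fun x => ENNReal.ofReal (p x / q x) := by
    rw [hμq, ← withDensity_mul _ (by fun_prop) (by fun_prop)]
    congr 1
    ext x
    rw [Pi.mul_apply, ← ENNReal.ofReal_mul (hq0 x).le, mul_div_cancel₀ _ (hq0 x).ne']
  have hd : Measurable fun x => ENNReal.ofReal (p x / q x) := by fun_prop
  rw [klDiv_eq_lintegral_klFun_of_ac (hpq ▸ withDensity_absolutelyContinuous _ _), hpq]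
  calc _ = ∫⁻ x, ENNReal.ofReal (klFun (p x / q x)) ∂μq := by
        refine lintegral_congr_ae ?_
        filter_upwards [Measure.rnDeriv_withDensity μq hd] with x hx
        rw [hx, ENNReal.toReal_ofReal (div_pos (hp0 x) (hq0 x)).le]
    _ = _ := by
        have hk : Measurable fun x => ENNReal.ofReal (klFun (p x / q x)) := by fun_prop
        rw [hμq, lintegral_withDensity_eq_lintegral_mul _ (by fun_prop) hk]
        refine lintegral_congr fun x => ?_
        rw [Pi.mul_apply, ENNReal.ofReal_mul (hq0 x).le]

variable {E : Type*} [NormedAddCommGroup E] [InnerProductSpace ℝ E] [FiniteDimensional ℝ E]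
  [MeasurableSpace E] [BorelSpace E]

lemma map_prodMk_channel {v : ℝ} (hv : 0 < v) (ν : Measure E) [IsProbabilityMeasure ν] (s : ℝ) :
    (ν.prod (isoGaussian E v)).map (fun p => (p.1, s • p.1 + p.2)) =
      (ν.prod (isoGaussian E v)).withDensity fun p => ENNReal.ofReal (gaussTilt v (s • p.1) p.2) := by
  have := isProbabilityMeasure_isoGaussian (E := E) hv
  refine Measure.ext_of_lintegral _ fun g hg => ?_
  rw [lintegral_map hg (by fun_prop), lintegral_withDensity_eq_lintegral_mul _ (by fun_prop) hg,
    lintegral_prod _ (Measurable.aemeasurable (by fun_prop)),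
    lintegral_prod _ (Measurable.aemeasurable (by fun_prop))]
  exact lintegral_congr fun x =>
    lintegral_add_isoGaussian hv (s • x) (g := fun z => g (x, z)) (by fun_prop)

lemma map_channel {v : ℝ} (hv : 0 < v) (ν : Measure E) [IsProbabilityMeasure ν] (s : ℝ) :
    (ν.prod (isoGaussian E v)).map (fun p => s • p.1 + p.2) =
      (isoGaussian E v).withDensity fun z => ENNReal.ofReal (mixTilt v ν s z) := by
  have := isProbabilityMeasure_isoGaussian (E := E) hv
  have hm := measurable_mixTilt v ν s
  refine Measure.ext_of_lintegral _ fun g hg => ?_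
  rw [lintegral_map hg (by fun_prop), lintegral_withDensity_eq_lintegral_mul _ (by fun_prop) hg,
    lintegral_prod _ (Measurable.aemeasurable (by fun_prop))]
  simp_rw [fun x => lintegral_add_isoGaussian hv (s • x) hg]
  rw [lintegral_lintegral_swap (Measurable.aemeasurable (by fun_prop))]
  refine lintegral_congr fun z => ?_
  rw [lintegral_mul_const _ (by fun_prop), Pi.mul_apply, ofReal_mixTilt hv]

lemma klDiv_channel {v : ℝ} (hv : 0 < v) (ν : Measure E) [IsProbabilityMeasure ν] (s : ℝ) :
    klDiv ((ν.prod (isoGaussian E v)).map (fun p => (p.1, s • p.1 + p.2)))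
      (ν.prod ((ν.prod (isoGaussian E v)).map (fun p => s • p.1 + p.2))) = gaussInfo v ν s := by
  have := isProbabilityMeasure_isoGaussian (E := E) hv
  have hm := measurable_mixTilt v ν s
  have h1 := map_prodMk_channel hv ν s
  have h2 : ν.prod ((ν.prod (isoGaussian E v)).map (fun p => s • p.1 + p.2)) =
      (ν.prod (isoGaussian E v)).withDensity fun p => ENNReal.ofReal (mixTilt v ν s p.2) := by
    rw [map_channel hv, prod_withDensity_right (by fun_prop)]
  have : IsFiniteMeasure ((ν.prod (isoGaussian E v)).withDensity
      fun p => ENNReal.ofReal (gaussTilt v (s • p.1) p.2)) := h1 ▸ inferInstance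
  have : IsFiniteMeasure ((ν.prod (isoGaussian E v)).withDensity
      fun p => ENNReal.ofReal (mixTilt v ν s p.2)) := h2 ▸ inferInstance
  rw [h1, h2, klDiv_withDensity_withDensity (p := fun p : E × E => gaussTilt v (s • p.1) p.2)
    (q := fun p => mixTilt v ν s p.2) (by fun_prop) (by fun_prop)
    (fun p => gaussTilt_pos _ _ _) (fun p => mixTilt_pos hv ν s p.2), gaussInfo]

/-- Rescaling the output does not change the information: only the ratio of the signal amplitude `a`
to the noise amplitude `b` matters. -/
lemma klDiv_channel_smul {v : ℝ} (hv : 0 < v) (ν : Measure E) [IsProbabilityMeasure ν] (a : ℝ)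
    {b : ℝ} (hb : b ≠ 0) :
    klDiv ((ν.prod (isoGaussian E v)).map (fun p => (p.1, a • p.1 + b • p.2)))
      (ν.prod ((ν.prod (isoGaussian E v)).map (fun p => a • p.1 + b • p.2))) =
      gaussInfo v ν (a / b) := by
  have := isProbabilityMeasure_isoGaussian (E := E) hv
  let e : E ≃ᵐ E := (Homeomorph.smulOfNeZero b hb).toMeasurableEquiv
  have he : ∀ x z : E, e ((a / b) • x + z) = a • x + b • z := fun x z => by
    change b • ((a / b) • x + z) = _
    rw [smul_add, smul_smul, mul_div_cancel₀ _ hb]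
  rw [← klDiv_channel hv ν (a / b)]
  have h1 : ⇑((MeasurableEquiv.refl E).prodCongr e) = Prod.map id e := rfl
  have : IsProbabilityMeasure ((ν.prod (isoGaussian E v)).map fun p => (a / b) • p.1 + p.2) :=
    Measure.isProbabilityMeasure_map (by fun_prop)
  refine Eq.trans ?_ (klDiv_map_measurableEquiv _ _ ((MeasurableEquiv.refl E).prodCongr e))
  rw [h1, ← Measure.map_prod_map _ _ measurable_id e.measurable, Measure.map_id,
    Measure.map_map (by fun_prop) (by fun_prop), Measure.map_map (by fun_prop) (by fun_prop)]
  simp only [Function.comp_def, Prod.map_apply, id_eq, he]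

lemma mutualInfo_linear_channel {v : ℝ} (hv : 0 < v) {ν : Measure E} [IsProbabilityMeasure ν]
    {Ω : Type*} [MeasurableSpace Ω] {P : Measure Ω} [IsProbabilityMeasure P] {X N Y : Ω → E}
    (hX : HasLaw X ν P) {a b : ℝ} (hb : b ≠ 0) (hN : HasLaw N ((isoGaussian E v).map (b • ·)) P)
    (hXN : IndepFun X N P) (hY : ∀ ω, Y ω = a • X ω + N ω) :
    mutualInfo P X Y = gaussInfo v ν (a / b) := by
  have := isProbabilityMeasure_isoGaussian (E := E) hv
  have hlaw : P.map (fun ω => (X ω, N ω)) =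
      (ν.prod (isoGaussian E v)).map (Prod.map id (b • ·)) := by
    rw [(indepFun_iff_map_prod_eq_prod_map_map hX.aemeasurable hN.aemeasurable).1 hXN, hX.map_eq,
      hN.map_eq, ← Measure.map_prod_map _ _ measurable_id (by fun_prop), Measure.map_id]
  have hXN' : AEMeasurable (fun ω => (X ω, N ω)) P := hX.aemeasurable.prodMk hN.aemeasurable
  have h1 : P.map (fun ω => (X ω, Y ω)) =
      (ν.prod (isoGaussian E v)).map (fun p => (p.1, a • p.1 + b • p.2)) := by
    have : (fun ω => (X ω, Y ω)) = (fun p : E × E => (p.1, a • p.1 + p.2)) ∘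
        fun ω => (X ω, N ω) := by
      ext ω <;> simp [hY]
    rw [this, ← AEMeasurable.map_map_of_aemeasurable (by fun_prop) hXN', hlaw,
      Measure.map_map (by fun_prop) (by fun_prop)]
    rfl
  have h2 : P.map Y = (ν.prod (isoGaussian E v)).map (fun p => a • p.1 + b • p.2) := by
    have : Y = (fun p : E × E => a • p.1 + p.2) ∘ fun ω => (X ω, N ω) := by
      ext ω; simp [hY]
    rw [this, ← AEMeasurable.map_map_of_aemeasurable (by fun_prop) hXN', hlaw,
      Measure.map_map (by fun_prop) (by fun_prop)]
    rfl
  rw [mutualInfo, h1, h2, hX.map_eq, klDiv_channel_smul hv ν a hb]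

end Channel

section ChainNoise

/-! ### The noise accumulated along the chain -/

variable {E : Type*} [NormedAddCommGroup E] [InnerProductSpace ℝ E]

/-- The part of the chain that the noise contributes: the recursion started at `0`. -/
noncomputable def chainNoise (α : ℕ → ℝ) (z : ℕ → E) : ℕ → E
  | 0 => 0
  | t + 1 => α t • chainNoise α z t + √(1 - α t ^ 2) • z t

lemma chainNoise_congr (α : ℕ → ℝ) {z z' : ℕ → E} {H : ℕ} (h : ∀ t < H, z t = z' t) :
    chainNoise α z H = chainNoise α z' H := by
  induction H with
  | zero => rfl
  | succ t ih =>
    rw [chainNoise, chainNoise, ih fun u hu => h u (hu.trans t.lt_succ_self), h t t.lt_succ_self]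

variable [FiniteDimensional ℝ E] [MeasurableSpace E] [BorelSpace E]

lemma measurable_chainNoise (α : ℕ → ℝ) (H : ℕ) :
    Measurable fun z : ℕ → E => chainNoise α z H := by
  induction H with
  | zero => exact measurable_const
  | succ t ih =>
    simp only [chainNoise]
    fun_prop

lemma chainNoise_indepFun {Ω : Type*} [MeasurableSpace Ω] {P : Measure Ω} {Z : ℕ → Ω → E}
    (hZm : ∀ t, AEMeasurable (Z t) P) (hZ : iIndepFun Z P) (α : ℕ → ℝ) (H : ℕ) :
    IndepFun (fun ω => chainNoise α (fun t => Z t ω) H) (Z H) P := by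
  have h := hZ.indepFun_finset₀ (Finset.range H) {H} (by simp) hZm
  -- the accumulated noise depends only on the first `H` noise vectors, so it factors through them
  let φ : (Finset.range H → E) → E := fun y =>
    chainNoise α (fun t => if ht : t ∈ Finset.range H then y ⟨t, ht⟩ else 0) H
  have hφ : Measurable φ := by
    refine (measurable_chainNoise α H).comp (measurable_pi_lambda _ fun t => ?_)
    by_cases ht : t ∈ Finset.range H
    · simp only [ht, dite_true]; fun_prop
    · simp only [ht, dite_false]; fun_prop
  have h2 := h.comp hφ (measurable_pi_apply (⟨H, by simp⟩ : ({H} : Finset ℕ)))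
  have h3 : (fun ω => chainNoise α (fun t => Z t ω) H) =
      φ ∘ fun ω (i : Finset.range H) => Z i ω := by
    ext ω
    refine chainNoise_congr α fun t ht => ?_
    simp [ht]
  rw [h3]
  exact h2

lemma cumAttenuation_mem_Icc {α : ℕ → ℝ} {H : ℕ} (h : ∀ t < H, 0 ≤ α t ∧ α t < 1) :
    0 ≤ cumAttenuation α H ∧ cumAttenuation α H ≤ 1 :=
  ⟨Finset.prod_nonneg fun t ht => (h t (Finset.mem_range.1 ht)).1,
    Finset.prod_le_one (fun t ht => (h t (Finset.mem_range.1 ht)).1)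
      fun t ht => (h t (Finset.mem_range.1 ht)).2.le⟩

lemma cumAttenuation_lt_one {α : ℕ → ℝ} {H : ℕ} (hH : 1 ≤ H) (h : ∀ t < H, 0 ≤ α t ∧ α t < 1) :
    cumAttenuation α H < 1 := by
  obtain ⟨n, rfl⟩ := Nat.exists_eq_succ_of_ne_zero (Nat.one_le_iff_ne_zero.1 hH)
  have h1 := cumAttenuation_mem_Icc fun t ht => h t (Nat.lt_succ_of_lt ht)
  have h2 := h n n.lt_succ_self
  rw [cumAttenuation, Finset.prod_range_succ]
  exact (mul_le_of_le_one_left h2.1 h1.2).trans_lt h2.2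

/-- However the schedule spreads it, the accumulated noise is Gaussian with variance
`v * (1 - ā ^ 2)`, where `ā` is the cumulative attenuation. -/
lemma hasLaw_chainNoise {v : ℝ} (hv : 0 < v) {Ω : Type*} [MeasurableSpace Ω] {P : Measure Ω}
    [IsProbabilityMeasure P] {Z : ℕ → Ω → E} (hZl : ∀ t, HasLaw (Z t) (isoGaussian E v) P)
    (hZ : iIndepFun Z P) {α : ℕ → ℝ} {H : ℕ} (h : ∀ t < H, 0 ≤ α t ∧ α t < 1) :
    HasLaw (fun ω => chainNoise α (fun t => Z t ω) H)
      ((isoGaussian E v).map (√(1 - cumAttenuation α H ^ 2) • ·)) P := by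
  have := isProbabilityMeasure_isoGaussian (E := E) hv
  have hm : ∀ H, AEMeasurable (fun ω => chainNoise α (fun t => Z t ω) H) P := fun H =>
    (measurable_chainNoise α H).comp_aemeasurable (aemeasurable_pi_lambda _ fun t =>
      (hZl t).aemeasurable)
  refine ⟨hm H, ?_⟩
  induction H with
  | zero =>
    simp [chainNoise, cumAttenuation]
  | succ t ih =>
    have ih := ih fun u hu => h u (hu.trans t.lt_succ_self)
    have ha := cumAttenuation_mem_Icc fun u hu => h u (Nat.lt_succ_of_lt hu)
    have ha' := cumAttenuation_mem_Icc h
    have hα := h t t.lt_succ_self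
    have hind := (chainNoise_indepFun (fun t => (hZl t).aemeasurable) hZ α t).comp
      (measurable_const_smul (α t)) (measurable_const_smul √(1 - α t ^ 2))
    have hsm : ∀ (c : ℝ) {Y : Ω → E}, AEMeasurable Y P → P.map ((c • ·) ∘ Y) =
        (P.map Y).map (c • ·) := fun c Y hY =>
      (AEMeasurable.map_map_of_aemeasurable (by fun_prop) hY).symm
    have := Measure.isProbabilityMeasure_map (hm (t + 1))
    have : IsProbabilityMeasure
        ((isoGaussian E v).map (√(1 - cumAttenuation α (t + 1) ^ 2) • ·)) :=
      Measure.isProbabilityMeasure_map (by fun_prop)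
    refine Measure.ext_of_charFun ?_
    have hsum := hind.charFun_map_fun_add_eq_mul
      ((measurable_const_smul (α t)).comp_aemeasurable (hm t))
      ((measurable_const_smul √(1 - α t ^ 2)).comp_aemeasurable (hZl t).aemeasurable)
    rw [hsm _ (hm t), hsm _ (hZl t).aemeasurable, ih, (hZl t).map_eq] at hsum
    refine hsum.trans ?_
    ext ξ
    simp only [Pi.mul_apply, charFun_map_smul, charFun_isoGaussian hv, ← Complex.exp_add,
      norm_smul, mul_pow, Real.norm_eq_abs, sq_abs]
    have h1 : cumAttenuation α (t + 1) = cumAttenuation α t * α t :=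
      Finset.prod_range_succ _ _
    rw [Real.sq_sqrt (sub_nonneg.2 (pow_le_one₀ ha.1 ha.2)),
      Real.sq_sqrt (sub_nonneg.2 (pow_le_one₀ ha'.1 ha'.2)),
      Real.sq_sqrt (sub_nonneg.2 (pow_le_one₀ hα.1 hα.2.le)), h1]
    congr 1
    push_cast
    ring

end ChainNoise

section ComplexGaussian

open Filter InformationTheory
open scoped InnerProductSpace

/-! ### The complex Gaussian law as an isotropic Gaussian -/

lemma charFun_complexGaussian (v : ℝ≥0) (t : ℂ) :
    charFun (complexGaussian v) t = Complex.exp (-(v * ‖t‖ ^ 2 / 2 : ℝ)) := by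
  have hm : Measurable fun p : ℝ × ℝ => (⟨p.1, p.2⟩ : ℂ) :=
    Complex.measurableEquivRealProd.symm.measurable
  rw [charFun_apply, complexGaussian, integral_map hm.aemeasurable
    (Continuous.aestronglyMeasurable (by fun_prop))]
  have h1 : ∀ p : ℝ × ℝ, Complex.exp (⟪(⟨p.1, p.2⟩ : ℂ), t⟫_ℝ * Complex.I) =
      Complex.exp (t.re * p.1 * Complex.I) * Complex.exp (t.im * p.2 * Complex.I) := by
    intro p
    rw [← Complex.exp_add, Complex.inner]
    congr 1
    simp only [Complex.mul_re, Complex.conj_re, Complex.conj_im]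
    push_cast
    ring
  simp_rw [h1]
  rw [integral_prod_mul (fun x : ℝ => Complex.exp (t.re * x * Complex.I))
    (fun y : ℝ => Complex.exp (t.im * y * Complex.I)), ← charFun_apply_real, ← charFun_apply_real,
    charFun_gaussianReal, charFun_gaussianReal, ← Complex.exp_add, Complex.sq_norm,
    Complex.normSq_apply]
  congr 1
  push_cast
  ring

instance isProbabilityMeasure_complexGaussian (v : ℝ≥0) :
    IsProbabilityMeasure (complexGaussian v) :=
  Measure.isProbabilityMeasure_map
    Complex.measurableEquivRealProd.symm.measurable.aemeasurable

lemma complexGaussianVec_eq_isoGaussian (d : ℕ) {v : ℝ≥0} (hv : 0 < v) :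
    complexGaussianVec d v = isoGaussian (EuclideanSpace ℂ (Fin d)) v := by
  have hv' : (0 : ℝ) < v := by exact_mod_cast hv
  have := isProbabilityMeasure_isoGaussian (E := EuclideanSpace ℂ (Fin d)) hv'
  have : IsProbabilityMeasure (complexGaussianVec d v) :=
    Measure.isProbabilityMeasure_map (Measurable.aemeasurable (by fun_prop))
  refine Measure.ext_of_charFun ?_
  ext t
  rw [charFun_isoGaussian hv', EuclideanSpace.norm_sq_eq]
  have h1 : charFun (complexGaussianVec d v) t = ∏ i, charFun (complexGaussian v) (t i) :=
    charFun_pi t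
  rw [h1]
  simp_rw [charFun_complexGaussian]
  rw [← Complex.exp_sum]
  congr 1
  push_cast
  rw [Finset.mul_sum, Finset.sum_div, Finset.sum_neg_distrib]

/-! ### The mutual information of the chain -/

lemma chain_eq_add {Ω : Type*} {d : ℕ} (α : ℕ → ℝ) (X₀ : Ω → EuclideanSpace ℂ (Fin d))
    (Z : ℕ → Ω → EuclideanSpace ℂ (Fin d)) (H : ℕ) (ω : Ω) :
    chain α X₀ Z H ω = cumAttenuation α H • X₀ ω + chainNoise α (fun t => Z t ω) H := by
  induction H with
  | zero => simp [chain, chainNoise, cumAttenuation]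
  | succ t ih =>
    simp only [chain, chainNoise, ih]
    have h : cumAttenuation α (t + 1) = cumAttenuation α t * α t := Finset.prod_range_succ _ _
    rw [h, smul_add, smul_smul, add_assoc, mul_comm]

lemma mutualInfo_chain {Ω : Type*} [MeasurableSpace Ω] {P : Measure Ω} [IsProbabilityMeasure P]
    {d : ℕ} {v : ℝ≥0} (hv : 0 < v) {ν : Measure (EuclideanSpace ℂ (Fin d))}
    [IsProbabilityMeasure ν] {X₀ : Ω → EuclideanSpace ℂ (Fin d)}
    {Z : ℕ → Ω → EuclideanSpace ℂ (Fin d)} (hX : HasLaw X₀ ν P)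
    (hZl : ∀ t, HasLaw (Z t) (complexGaussianVec d v) P) (hZ : iIndepFun Z P)
    (hXZ : IndepFun X₀ (fun ω t => Z t ω) P) {H : ℕ} {α : ℕ → ℝ} (hH : 1 ≤ H)
    (hα : ∀ t < H, 0 ≤ α t ∧ α t < 1) :
    mutualInfo P X₀ (chain α X₀ Z H) = gaussInfo v ν √(effectiveSNR α H) := by
  have hv' : (0 : ℝ) < v := by exact_mod_cast hv
  rw [complexGaussianVec_eq_isoGaussian d hv] at hZl
  have h0 := (cumAttenuation_mem_Icc hα).1
  have h1 : 0 < 1 - cumAttenuation α H ^ 2 :=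
    sub_pos.2 (pow_lt_one₀ h0 (cumAttenuation_lt_one hH hα) two_ne_zero)
  have hsqrt : √(effectiveSNR α H) = cumAttenuation α H / √(1 - cumAttenuation α H ^ 2) := by
    rw [effectiveSNR, Real.sqrt_div (sq_nonneg _), Real.sqrt_sq h0]
  rw [hsqrt]
  exact mutualInfo_linear_channel hv' hX (Real.sqrt_pos.2 h1).ne'
    (hasLaw_chainNoise hv' hZl hZ hα) (hXZ.comp measurable_id (measurable_chainNoise α H))
    (chain_eq_add α X₀ Z H)

lemma isLittleO_gaussInfo_sqrt {E : Type*} [NormedAddCommGroup E] [InnerProductSpace ℝ E]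
    [FiniteDimensional ℝ E] [MeasurableSpace E] [BorelSpace E] {v : ℝ≥0} (hv : 0 < v)
    {ν : Measure E} [IsProbabilityMeasure ν] (hν : MemLp id 2 ν) :
    (fun γ : ℝ => (gaussInfo v ν √γ).toReal - γ / (2 * v) * ∫ x, ‖x - ∫ y, y ∂ν‖ ^ 2 ∂ν)
      =o[𝓝[>] 0] (fun γ : ℝ => γ) := by
  set M := ∫ x, ‖x - ∫ y, y ∂ν‖ ^ 2 ∂ν with hM
  have hM0 : 0 ≤ M := integral_nonneg fun x => sq_nonneg _
  have hs : Tendsto (fun γ : ℝ => √γ) (𝓝[>] 0) (𝓝[>] 0) := by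
    refine tendsto_nhdsWithin_iff.2 ⟨?_, ?_⟩
    · have := (Real.continuous_sqrt.tendsto 0).mono_left (nhdsWithin_le_nhds (s := Set.Ioi 0))
      rwa [Real.sqrt_zero] at this
    · filter_upwards [self_mem_nhdsWithin] with γ hγ using Real.sqrt_pos.2 hγ
  have h1 := (ENNReal.tendsto_toReal ENNReal.ofReal_ne_top).comp
    ((tendsto_gaussInfo_div_sq hv hν).comp hs)
  rw [← hM, ENNReal.toReal_ofReal (by positivity)] at h1
  have h2 := h1.sub_const (M / (2 * v))
  rw [sub_self] at h2
  refine (isLittleO_iff_tendsto' ?_).2 (h2.congr' ?_)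
  · filter_upwards [self_mem_nhdsWithin] with γ (hγ : 0 < γ) h0 using absurd h0 hγ.ne'
  · filter_upwards [self_mem_nhdsWithin] with γ (hγ : 0 < γ)
    simp only [Function.comp_apply]
    rw [Real.sq_sqrt hγ.le, ENNReal.toReal_mul, ENNReal.toReal_ofReal (by positivity)]
    field_simp

end ComplexGaussian

theorem mainTheorem1 (d : ℕ) (v : ℝ≥0) (hv : 0 < v)
    (ν : Measure (EuclideanSpace ℂ (Fin d))) [IsProbabilityMeasure ν] (hν : MemLp id 2 ν) :
    ∃ J : ℝ → ℝ≥0,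
      -- the mutual information is `J(γ_H)`, whatever the number of hops and the schedule
      (∀ (Ω : Type*) [MeasurableSpace Ω] (P : Measure Ω) [IsProbabilityMeasure P]
        (X₀ : Ω → EuclideanSpace ℂ (Fin d)) (Z : ℕ → Ω → EuclideanSpace ℂ (Fin d)),
        HasLaw X₀ ν P → (∀ t, HasLaw (Z t) (complexGaussianVec d v) P) →
        iIndepFun Z P → IndepFun X₀ (fun ω t => Z t ω) P →
        ∀ (H : ℕ) (α : ℕ → ℝ), 1 ≤ H → (∀ t < H, 0 ≤ α t ∧ α t < 1) →
          mutualInfo P X₀ (chain α X₀ Z H) = (J (effectiveSNR α H) : ℝ≥0∞)) ∧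
      -- regularity of `J`
      ContinuousOn J (Set.Ici 0) ∧
      ((¬ ∃ c, ∀ᵐ x ∂ν, x = c) → StrictMonoOn J (Set.Ici 0)) ∧
      -- small-SNR expansion, in general and for a centred source
      (fun γ : ℝ => (J γ : ℝ) - γ / (2 * v) * ∫ x, ‖x - ∫ y, y ∂ν‖ ^ 2 ∂ν)
        =o[𝓝[>] 0] (fun γ : ℝ => γ) ∧
      (∫ x, x ∂ν = 0 →
        (fun γ : ℝ => (J γ : ℝ) - γ / (2 * v) * ∫ x, ‖x‖ ^ 2 ∂ν)
          =o[𝓝[>] 0] (fun γ : ℝ => γ)) := by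
  have hfin := fun s => gaussInfo_ne_top hv hν s
  refine ⟨fun γ => (gaussInfo v ν √γ).toNNReal, ?_, ?_, ?_, ?_, ?_⟩
  · intro Ω _ P _ X₀ Z hX hZl hZ hXZ H α hH hα
    rw [mutualInfo_chain hv hX hZl hZ hXZ hH hα, ENNReal.coe_toNNReal (hfin _)]
  · refine Continuous.continuousOn (continuous_iff_continuousAt.2 fun γ => ?_)
    exact (ENNReal.tendsto_toNNReal (hfin _)).comp
      (((continuous_gaussInfo hv hν).comp Real.continuous_sqrt).tendsto γ)
  · intro hne γ₁ hγ₁ γ₂ _ hlt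
    exact ENNReal.toNNReal_strict_mono (hfin _) (gaussInfo_lt_gaussInfo hv hν hne
      (Real.sqrt_nonneg _) (Real.sqrt_lt_sqrt hγ₁ hlt))
  · exact isLittleO_gaussInfo_sqrt hv hν
  · intro hmean
    have h := isLittleO_gaussInfo_sqrt hv hν
    simp only [hmean, sub_zero] at h
    exact h
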